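/- Let $k$ be a field and let $C$ be a cocommutative rack bialgebra over $k$: a counital, coassociative, cocommutative coalgebra $(C,\triangle,\epsilon)$ with a group-like element $1\in C$ and a morphism of counital coalgebras $C\otimes C\to C$, $x\otimes y\mapsto x\lhd y$, such that for all $x,y,z\in C$ $$(x\lhd y)\lhd z=(x\lhd z_{(1)})\lhd(y\lhd z_{(2)}),\qquad x\lhd 1=x,\qquad 1\lhd x=\epsilon(x)1 .$$ Put $\check C=\ker\epsilon$, let $i\colon C\to T(\check C)$ be the linear map that is the inclusion on $\check C$ and sends $1$ to $1$, let $$U=U(C)=T(\check C)\big/\big\langle\, i(y_{(1)})\,i(x\lhd y_{(2)})-i(x)\,i(y)\ \big|\ x,y\in C\,\big\rangle ,$$ and let $q\colon C\to U$ be the map induced by $i$. Equip $U$ with the bialgebra structure determined by $\triangle(q(c))=q(c_{(1)})\otimes q(c_{(2)})$, $\epsilon(q(c))=\epsilon(c)$; equip $\check C$ with the right $U$-action determined by $x\cdot q(c)=x\lhd c$ and the right $U$-coaction $x\mapsto x_{(0)}\otimes x_{(1)}:=(x_{(1)}-\epsilon(x_{(1)})1)\otimes q(x_{(2)})$, where the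 right-hand side is formed with $\triangle(x)=x_{(1)}\otimes x_{(2)}$ in $C$. Let $M=U\otimes\check C$ with the actions and coactions ($g,h,g'\in U$, $v\in\check C$) $$g(h\otimes v)g'=ghg'_{(1)}\otimes v\cdot g'_{(2)},\qquad h\otimes v\mapsto h_{(1)}\otimes(h_{(2)}\otimes v)\in U\otimes M,\qquad h\otimes v\mapsto (h_{(1)}\otimes v_{(0)})\otimes h_{(2)}v_{(1)}\in M\otimes U,$$ and let $f\colon M\to U$, $f(x\otimes y)=x\,q(y)$. Then: 1. $M$ is a Hopf tetramodule over $U$, i.e. a $U$-bimodule and a $U$-bicomodule whose two coactions are morphisms of $U$-bimodules (for the diagonal actions on $U\otimes M$ and $M\otimes U$). 2. $f$ is $U$-bilinear, and it is a coderivation: $\triangle(f(m))=m_{(-1)}\otimes f(m_{(0)})+f(m_{(0)})\otimes m_{(1)}$ for all $m \in M$, where $m\mapsto m_{(-1)}\otimes m_{(0)}$ and $m\mapsto m_{(0)}\otimes m_{(1)}$ denote the left and right coactions. 3. $f\colon M\to U$ is a bialgebra object in Loday–Pirashvili's symmetric monoidal category $\mathcal{LM}$. Here the objects of $\mathcal{LM}$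 are linear maps of $k$-vector spaces, the morphisms are commutative squares, the tensor product is $$(a\colon A_1\to A_0)\otimes(b\colon B_1\to B_0)=\big(a\otimes \mathrm{id}+\mathrm{id}\otimes b\colon (A_1\otimes B_0)\oplus(A_0\otimes B_1)\to A_0\otimes B_0\big),$$ the unit object is $0\to k$, and the symmetry is the tensor flip. The structure maps of the bialgebra object $f$ are the bialgebra structure of $U$ in degree $0$; in degree $1$ the product is given by the right and left actions $M\otimes U\oplus U\otimes M\to M$, the coproduct by the right and left coactions $M\to M\otimes U\oplus U\otimes M$, and the unit and counit are zero. -/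

import Mathlib

open scoped TensorProduct

universe u v

noncomputable section

section LodayPirashvili

open CategoryTheory MonoidalCategory

/-- Objects of the Loday-Pirashvili category: linear maps `map : src → tgt` of `k`-vector spaces.
The universe is `max u v` so that the unit object exists for every field `k : Type u`. -/
structure LinMap (k : Type u) [Field k] where
  src : Type (max u v)
  tgt : Type (max u v)
  [srcAddCommGroup : AddCommGroup src]
  [srcModule : Module k src]
  [tgtAddCommGroup : AddCommGroup tgt]
  [tgtModule : Module k tgt]
  map : src →ₗ[k] tgt

namespace LinMap

attribute [instance] srcAddCommGroup srcModule tgtAddCommGroup tgtModule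

variable {k : Type u} [Field k]

/-- Morphisms are commutative squares. -/
@[ext]
structure Hom (X Y : LinMap.{u, v} k) where
  src : X.src →ₗ[k] Y.src
  tgt : X.tgt →ₗ[k] Y.tgt
  comm : Y.map ∘ₗ src = tgt ∘ₗ X.map

instance : Category (LinMap.{u, v} k) where
  Hom X Y := Hom X Y
  id X := ⟨LinearMap.id, LinearMap.id, rfl⟩
  comp f g := ⟨g.src ∘ₗ f.src, g.tgt ∘ₗ f.tgt, by
    rw [← LinearMap.comp_assoc, g.comm, LinearMap.comp_assoc, f.comm, LinearMap.comp_assoc]⟩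

@[ext]
theorem hom_ext {X Y : LinMap.{u, v} k} {f g : X ⟶ Y} (hs : f.src = g.src)
    (ht : f.tgt = g.tgt) : f = g := Hom.ext hs ht

@[simp] theorem id_src (X : LinMap.{u, v} k) : Hom.src (𝟙 X) = LinearMap.id := rfl
@[simp] theorem id_tgt (X : LinMap.{u, v} k) : Hom.tgt (𝟙 X) = LinearMap.id := rfl
@[simp] theorem comp_src {X Y Z : LinMap.{u, v} k} (f : X ⟶ Y) (g : Y ⟶ Z) :
    (f ≫ g).src = g.src ∘ₗ f.src := rfl
@[simp] theorem comp_tgt {X Y Z : LinMap.{u, v} k} (f : X ⟶ Y) (g : Y ⟶ Z) :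
    (f ≫ g).tgt = g.tgt ∘ₗ f.tgt := rfl

theorem comm_apply {X Y : LinMap.{u, v} k} (f : X ⟶ Y) (x : X.src) :
    Y.map (f.src x) = f.tgt (X.map x) := LinearMap.congr_fun f.comm x

/-- An isomorphism from a commutative square with invertible sides. -/
def mkIso {X Y : LinMap.{u, v} k} (s : X.src ≃ₗ[k] Y.src) (t : X.tgt ≃ₗ[k] Y.tgt)
    (h : Y.map ∘ₗ s.toLinearMap = t.toLinearMap ∘ₗ X.map) : X ≅ Y where
  hom := ⟨s.toLinearMap, t.toLinearMap, h⟩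
  inv := ⟨s.symm.toLinearMap, t.symm.toLinearMap, by
    ext y
    have := LinearMap.congr_fun h (s.symm y)
    simp at this
    simp [this]⟩
  hom_inv_id := by ext <;> simp
  inv_hom_id := by ext <;> simp

@[simp] theorem mkIso_hom_src {X Y : LinMap.{u, v} k} (s : X.src ≃ₗ[k] Y.src)
    (t : X.tgt ≃ₗ[k] Y.tgt) (h) : (mkIso s t h).hom.src = s.toLinearMap := rfl
@[simp] theorem mkIso_hom_tgt {X Y : LinMap.{u, v} k} (s : X.src ≃ₗ[k] Y.src)
    (t : X.tgt ≃ₗ[k] Y.tgt) (h) : (mkIso s t h).hom.tgt = t.toLinearMap := rfl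
@[simp] theorem mkIso_inv_src {X Y : LinMap.{u, v} k} (s : X.src ≃ₗ[k] Y.src)
    (t : X.tgt ≃ₗ[k] Y.tgt) (h) : (mkIso s t h).inv.src = s.symm.toLinearMap := rfl
@[simp] theorem mkIso_inv_tgt {X Y : LinMap.{u, v} k} (s : X.src ≃ₗ[k] Y.src)
    (t : X.tgt ≃ₗ[k] Y.tgt) (h) : (mkIso s t h).inv.tgt = t.symm.toLinearMap := rfl

/-- The infinitesimal tensor product
`(f : M → H) ⊗ (g : N → K) = ((f ⊗ 1) + (1 ⊗ g) : (M ⊗ K) ⊕ (H ⊗ N) → H ⊗ K)`. -/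
abbrev tensor (X Y : LinMap.{u, v} k) : LinMap.{u, v} k where
  src := (X.src ⊗[k] Y.tgt) × (X.tgt ⊗[k] Y.src)
  tgt := X.tgt ⊗[k] Y.tgt
  map := LinearMap.coprod (TensorProduct.map X.map LinearMap.id)
    (TensorProduct.map LinearMap.id Y.map)

variable (k) in
/-- The unit object `0 → k`. -/
abbrev unit : LinMap.{u, v} k where
  src := PUnit
  tgt := ULift.{v} k
  map := 0

/-- Tensor product of morphisms. -/
@[simps]
def tensorMap {X Y X' Y' : LinMap.{u, v} k} (f : X ⟶ Y) (g : X' ⟶ Y') :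
    tensor X X' ⟶ tensor Y Y' where
  src := LinearMap.prodMap (TensorProduct.map f.src g.tgt) (TensorProduct.map f.tgt g.src)
  tgt := TensorProduct.map f.tgt g.tgt
  comm := by
    ext <;> simp [comm_apply]

theorem prodRight_symm_pair {A B C : Type*} [AddCommGroup A] [Module k A] [AddCommGroup B]
    [Module k B] [AddCommGroup C] [Module k C] (p : (A ⊗[k] B) × (A ⊗[k] C)) :
    (TensorProduct.prodRight k k A B C).symm p =
      TensorProduct.map LinearMap.id (LinearMap.inl k B C) p.1 +
        TensorProduct.map LinearMap.id (LinearMap.inr k B C) p.2 := rfl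

/-- The associator, built from the ones of vector spaces and distributivity. -/
def assoc (X Y Z : LinMap.{u, v} k) : tensor (tensor X Y) Z ≅ tensor X (tensor Y Z) :=
  mkIso
    (((TensorProduct.prodLeft k k (X.src ⊗[k] Y.tgt) (X.tgt ⊗[k] Y.src) Z.tgt).prodCongr
        (LinearEquiv.refl k ((X.tgt ⊗[k] Y.tgt) ⊗[k] Z.src))) ≪≫ₗ
      LinearEquiv.prodAssoc k _ _ _ ≪≫ₗ
      ((TensorProduct.assoc k X.src Y.tgt Z.tgt).prodCongr
        (((TensorProduct.assoc k X.tgt Y.src Z.tgt).prodCongr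
          (TensorProduct.assoc k X.tgt Y.tgt Z.src)) ≪≫ₗ
          (TensorProduct.prodRight k k X.tgt (Y.src ⊗[k] Z.tgt) (Y.tgt ⊗[k] Z.src)).symm)))
    (TensorProduct.assoc k X.tgt Y.tgt Z.tgt)
    (by ext <;> simp [prodRight_symm_pair])


/-- The left unitor, `1 ⊗ x ↦ x` in both degrees. -/
def leftUnit (X : LinMap.{u, v} k) : tensor (unit k) X ≅ X :=
  mkIso
    { toFun := fun p => TensorProduct.lid k X.src
        (TensorProduct.map (ULift.moduleEquiv : ULift.{v} k ≃ₗ[k] k).toLinearMap LinearMap.id p.2)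
      invFun := fun x => (0, ULift.up 1 ⊗ₜ x)
      map_add' := by intros; simp
      map_smul' := by intros; simp
      left_inv := by
        rintro ⟨p, q⟩
        refine Prod.ext ?_ ?_
        · induction p with
          | zero => rfl
          | tmul x y => simp [Subsingleton.elim x 0]
          | add x y hx hy => simp_all
        · induction q with
          | zero => simp
          | tmul x y =>
            simp only [TensorProduct.map_tmul, TensorProduct.lid_tmul, TensorProduct.tmul_smul]
            rw [TensorProduct.smul_tmul']
            congr 1
            ext
            simp
          | add x y hx hy => simp_all [TensorProduct.tmul_add]
      right_inv := by intro x; simp }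
    ((TensorProduct.congr (ULift.moduleEquiv : ULift.{v} k ≃ₗ[k] k) (LinearEquiv.refl k X.tgt)) ≪≫ₗ
      TensorProduct.lid k X.tgt)
    (by ext <;> simp)

/-- The symmetry, given by the tensor flips. -/
def braid (X Y : LinMap.{u, v} k) : tensor X Y ≅ tensor Y X :=
  mkIso
    ((LinearEquiv.prodComm k _ _) ≪≫ₗ
      ((TensorProduct.comm k X.tgt Y.src).prodCongr (TensorProduct.comm k X.src Y.tgt)))
    (TensorProduct.comm k X.tgt Y.tgt)
    (by ext <;> simp)

/-- The right unitor, `x ⊗ 1 ↦ x` in both degrees. -/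
def rightUnit (X : LinMap.{u, v} k) : tensor X (unit k) ≅ X :=
  braid X (unit k) ≪≫ leftUnit X


theorem assoc_naturality {X₁ X₂ X₃ Y₁ Y₂ Y₃ : LinMap.{u, v} k} (f₁ : X₁ ⟶ Y₁) (f₂ : X₂ ⟶ Y₂)
    (f₃ : X₃ ⟶ Y₃) : tensorMap (tensorMap f₁ f₂) f₃ ≫ (assoc Y₁ Y₂ Y₃).hom =
      (assoc X₁ X₂ X₃).hom ≫ tensorMap f₁ (tensorMap f₂ f₃) := by
  ext <;> simp [assoc, prodRight_symm_pair]

theorem pentagon (W X Y Z : LinMap.{u, v} k) :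
    tensorMap (assoc W X Y).hom (𝟙 Z) ≫ (assoc W (tensor X Y) Z).hom ≫
        tensorMap (𝟙 W) (assoc X Y Z).hom =
      (assoc (tensor W X) Y Z).hom ≫ (assoc W X (tensor Y Z)).hom := by
  ext <;> simp [assoc, prodRight_symm_pair]

theorem triangle (X Y : LinMap.{u, v} k) :
    (assoc X (unit k) Y).hom ≫ tensorMap (𝟙 X) (leftUnit Y).hom =
      tensorMap (rightUnit X).hom (𝟙 Y) := by
  ext <;> simp [assoc, leftUnit, rightUnit, braid, prodRight_symm_pair, TensorProduct.smul_tmul']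

theorem leftUnit_naturality {X Y : LinMap.{u, v} k} (f : X ⟶ Y) :
    tensorMap (𝟙 (unit k)) f ≫ (leftUnit Y).hom = (leftUnit X).hom ≫ f := by
  ext <;> simp [leftUnit]

theorem rightUnit_naturality {X Y : LinMap.{u, v} k} (f : X ⟶ Y) :
    tensorMap f (𝟙 (unit k)) ≫ (rightUnit Y).hom = (rightUnit X).hom ≫ f := by
  ext <;> simp [leftUnit, rightUnit, braid]

theorem braid_naturality {X Y X' Y' : LinMap.{u, v} k} (f : X ⟶ Y) (g : X' ⟶ Y') :
    tensorMap f g ≫ (braid Y Y').hom = (braid X X').hom ≫ tensorMap g f := by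
  ext <;> simp [braid]

theorem hexagon_forward (X Y Z : LinMap.{u, v} k) :
    (assoc X Y Z).hom ≫ (braid X (tensor Y Z)).hom ≫ (assoc Y Z X).hom =
      tensorMap (braid X Y).hom (𝟙 Z) ≫ (assoc Y X Z).hom ≫ tensorMap (𝟙 Y) (braid X Z).hom := by
  ext <;> simp [braid, assoc, prodRight_symm_pair]

theorem braid_symmetry (X Y : LinMap.{u, v} k) : (braid X Y).hom ≫ (braid Y X).hom = 𝟙 _ := by
  ext <;> simp [braid]

theorem braid_symmetry_assoc (X Y : LinMap.{u, v} k) {Z : LinMap.{u, v} k} (h : tensor X Y ⟶ Z) :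
    (braid X Y).hom ≫ (braid Y X).hom ≫ h = h := by
  rw [← Category.assoc, braid_symmetry, Category.id_comp]

theorem tensorMap_id (X Y : LinMap.{u, v} k) : tensorMap (𝟙 X) (𝟙 Y) = 𝟙 (tensor X Y) := by
  ext <;> simp

theorem tensorMap_comp {X₁ Y₁ Z₁ X₂ Y₂ Z₂ : LinMap.{u, v} k} (f₁ : X₁ ⟶ Y₁) (f₂ : X₂ ⟶ Y₂)
    (g₁ : Y₁ ⟶ Z₁) (g₂ : Y₂ ⟶ Z₂) :
    tensorMap f₁ f₂ ≫ tensorMap g₁ g₂ = tensorMap (f₁ ≫ g₁) (f₂ ≫ g₂) := by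
  ext <;> simp

theorem tensorMap_comp_assoc {X₁ Y₁ Z₁ X₂ Y₂ Z₂ : LinMap.{u, v} k} (f₁ : X₁ ⟶ Y₁) (f₂ : X₂ ⟶ Y₂)
    (g₁ : Y₁ ⟶ Z₁) (g₂ : Y₂ ⟶ Z₂) {W : LinMap.{u, v} k} (h : tensor Z₁ Z₂ ⟶ W) :
    tensorMap f₁ f₂ ≫ tensorMap g₁ g₂ ≫ h = tensorMap (f₁ ≫ g₁) (f₂ ≫ g₂) ≫ h := by
  rw [← Category.assoc, tensorMap_comp]

theorem hexagon_reverse (X Y Z : LinMap.{u, v} k) :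
    (assoc X Y Z).inv ≫ (braid (tensor X Y) Z).hom ≫ (assoc Z X Y).inv =
      tensorMap (𝟙 X) (braid Y Z).hom ≫ (assoc X Z Y).inv ≫ tensorMap (braid X Z).hom (𝟙 Y) := by
  have h := hexagon_forward Z X Y
  have hA : ((assoc Z X Y).hom ≫ (braid Z (tensor X Y)).hom ≫ (assoc X Y Z).hom) ≫
      ((assoc X Y Z).inv ≫ (braid (tensor X Y) Z).hom ≫ (assoc Z X Y).inv) = 𝟙 _ := by
    simp [braid_symmetry_assoc]
  have hB : (tensorMap (𝟙 X) (braid Y Z).hom ≫ (assoc X Z Y).inv ≫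
        tensorMap (braid X Z).hom (𝟙 Y)) ≫
      (tensorMap (braid Z X).hom (𝟙 Y) ≫ (assoc X Z Y).hom ≫
        tensorMap (𝟙 X) (braid Z Y).hom) = 𝟙 _ := by
    simp [tensorMap_comp_assoc, tensorMap_comp, braid_symmetry, tensorMap_id]
  rw [← h] at hB
  rw [← Category.id_comp ((assoc X Y Z).inv ≫ _), ← hB, Category.assoc, hA, Category.comp_id]

instance : MonoidalCategoryStruct (LinMap.{u, v} k) where
  tensorObj := tensor
  whiskerLeft X _ _ f := tensorMap (𝟙 X) f
  whiskerRight f Y := tensorMap f (𝟙 Y)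
  tensorHom f g := tensorMap f g
  tensorUnit := unit k
  associator := assoc
  leftUnitor := leftUnit
  rightUnitor := rightUnit

instance : MonoidalCategory (LinMap.{u, v} k) :=
  MonoidalCategory.ofTensorHom
    (id_tensorHom_id := tensorMap_id)
    (id_tensorHom := fun _ _ _ _ => rfl)
    (tensorHom_id := fun _ _ => rfl)
    (tensorHom_comp_tensorHom := tensorMap_comp)
    (associator_naturality := assoc_naturality)
    (leftUnitor_naturality := leftUnit_naturality)
    (rightUnitor_naturality := rightUnit_naturality)
    (pentagon := pentagon)
    (triangle := triangle)

instance : SymmetricCategory (LinMap.{u, v} k) where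
  braiding := braid
  braiding_naturality_right X _ _ f := braid_naturality (𝟙 X) f
  braiding_naturality_left f Z := braid_naturality f (𝟙 Z)
  hexagon_forward := hexagon_forward
  hexagon_reverse X Y Z := by
    exact hexagon_reverse X Y Z
  symmetry := braid_symmetry

end LinMap

end LodayPirashvili

section Tetramodules

open Coalgebra

/-- A Hopf tetramodule over a bialgebra `H`: an `H`-bimodule and `H`-bicomodule `M` such that both
coactions are morphisms of `H`-bimodules (for the diagonal actions on `H ⊗ M` and `M ⊗ H`). -/
structure IsHopfTetramodule {k H M : Type*} [Field k] [Ring H] [Bialgebra k H] [AddCommGroup M]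
    [Module k M] (lact : H ⊗[k] M →ₗ[k] M) (ract : M ⊗[k] H →ₗ[k] M)
    (lcoact : M →ₗ[k] H ⊗[k] M) (rcoact : M →ₗ[k] M ⊗[k] H) : Prop where
  one_lact : ∀ m, lact (1 ⊗ₜ m) = m
  mul_lact : ∀ g h m, lact ((g * h) ⊗ₜ m) = lact (g ⊗ₜ lact (h ⊗ₜ m))
  ract_one : ∀ m, ract (m ⊗ₜ 1) = m
  ract_mul : ∀ m g h, ract (m ⊗ₜ (g * h)) = ract (ract (m ⊗ₜ g) ⊗ₜ h)
  lact_ract : ∀ g m h, ract (lact (g ⊗ₜ m) ⊗ₜ h) = lact (g ⊗ₜ ract (m ⊗ₜ h))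
  counit_lcoact : ∀ m, TensorProduct.lid k M ((counit (R := k) (A := H)).rTensor M (lcoact m)) = m
  comul_lcoact : ∀ m, TensorProduct.assoc k H H M ((comul (R := k) (A := H)).rTensor M (lcoact m)) =
    lcoact.lTensor H (lcoact m)
  rcoact_counit : ∀ m, TensorProduct.rid k M ((counit (R := k) (A := H)).lTensor M (rcoact m)) = m
  rcoact_comul : ∀ m, TensorProduct.assoc k M H H (rcoact.rTensor H (rcoact m)) =
    (comul (R := k) (A := H)).lTensor M (rcoact m)
  lcoact_rcoact : ∀ m, TensorProduct.assoc k H M H (lcoact.rTensor H (rcoact m)) =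
    rcoact.lTensor H (lcoact m)
  lcoact_lact : ∀ h m, lcoact (lact (h ⊗ₜ m)) = TensorProduct.map (LinearMap.mul' k H) lact
    (TensorProduct.tensorTensorTensorComm k H H H M (comul (R := k) h ⊗ₜ lcoact m))
  lcoact_ract : ∀ m h, lcoact (ract (m ⊗ₜ h)) = TensorProduct.map (LinearMap.mul' k H) ract
    (TensorProduct.tensorTensorTensorComm k H M H H (lcoact m ⊗ₜ comul (R := k) h))
  rcoact_lact : ∀ h m, rcoact (lact (h ⊗ₜ m)) = TensorProduct.map lact (LinearMap.mul' k H)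
    (TensorProduct.tensorTensorTensorComm k H H M H (comul (R := k) h ⊗ₜ rcoact m))
  rcoact_ract : ∀ m h, rcoact (ract (m ⊗ₜ h)) = TensorProduct.map ract (LinearMap.mul' k H)
    (TensorProduct.tensorTensorTensorComm k M H H H (rcoact m ⊗ₜ comul (R := k) h))

/-- `f : M → H` is a morphism of `H`-bimodules. -/
def IsBilinearTo {k H M : Type*} [Field k] [Ring H] [Algebra k H] [AddCommGroup M] [Module k M]
    (lact : H ⊗[k] M →ₗ[k] M) (ract : M ⊗[k] H →ₗ[k] M) (f : M →ₗ[k] H) : Prop :=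
  (∀ h m, f (lact (h ⊗ₜ m)) = h * f m) ∧ ∀ m h, f (ract (m ⊗ₜ h)) = f m * h

/-- `f : M → H` is a coderivation: `Δ(f m) = m₍₋₁₎ ⊗ f(m₍₀₎) + f(m₍₀₎) ⊗ m₍₁₎`. -/
def IsCoderivation {k H M : Type*} [Field k] [Ring H] [Bialgebra k H] [AddCommGroup M] [Module k M]
    (lcoact : M →ₗ[k] H ⊗[k] M) (rcoact : M →ₗ[k] M ⊗[k] H) (f : M →ₗ[k] H) : Prop :=
  ∀ m, comul (R := k) (f m) = f.lTensor H (lcoact m) + f.rTensor H (rcoact m)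

variable (k H V : Type*) [Field k] [Ring H] [Bialgebra k H] [AddCommGroup V] [Module k V]

/-- `g (h ⊗ v) = g h ⊗ v` on `H ⊗ V`. -/
def leftAct : H ⊗[k] (H ⊗[k] V) →ₗ[k] H ⊗[k] V :=
  TensorProduct.map (LinearMap.mul' k H) LinearMap.id ∘ₗ
    (TensorProduct.assoc k H H V).symm.toLinearMap

/-- `(h ⊗ v) ↦ h₁ ⊗ (h₂ ⊗ v)` on `H ⊗ V`. -/
def leftCoact : H ⊗[k] V →ₗ[k] H ⊗[k] (H ⊗[k] V) :=
  (TensorProduct.assoc k H H V).toLinearMap ∘ₗ TensorProduct.map comul LinearMap.id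

variable {k H V}

/-- `(h ⊗ v) g = h g₁ ⊗ v · g₂` on `H ⊗ V`, for a right action of `H` on `V`. -/
def rightAct (act : V ⊗[k] H →ₗ[k] V) : (H ⊗[k] V) ⊗[k] H →ₗ[k] H ⊗[k] V :=
  TensorProduct.map (LinearMap.mul' k H) act ∘ₗ
    (TensorProduct.tensorTensorTensorComm k H V H H).toLinearMap ∘ₗ
    TensorProduct.map LinearMap.id comul

/-- `(h ⊗ v) ↦ (h₁ ⊗ v₍₀₎) ⊗ h₂ v₍₁₎` on `H ⊗ V`, for a right coaction of `H` on `V`. -/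
def rightCoact (coact : V →ₗ[k] V ⊗[k] H) : H ⊗[k] V →ₗ[k] (H ⊗[k] V) ⊗[k] H :=
  TensorProduct.map LinearMap.id (LinearMap.mul' k H) ∘ₗ
    (TensorProduct.tensorTensorTensorComm k H H V H).toLinearMap ∘ₗ
    TensorProduct.map comul coact

end Tetramodules

/-- A rack bialgebra structure on a counital coassociative coalgebra `C`: a group-like element `1`
and a morphism of counital coalgebras `rack : C ⊗ C → C`, `x ⊗ y ↦ x ◁ y`, such that
`(x ◁ y) ◁ z = (x ◁ z₁) ◁ (y ◁ z₂)`, `x ◁ 1 = x` and `1 ◁ x = ε(x) 1`. -/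
class RackBialgebra (k : Type u) (C : Type v) [Field k] [AddCommGroup C] [Module k C]
    [Coalgebra k C] where
  /-- The distinguished group-like element. -/
  one : C
  /-- The rack product. It commutes with `Δ`, and `ε (x ◁ y) = ε x * ε y`. -/
  rack : C ⊗[k] C →ₗc[k] C
  counit_one : Coalgebra.counit (R := k) one = 1
  comul_one : Coalgebra.comul (R := k) one = one ⊗ₜ[k] one
  self_distrib : ∀ x y z : C, rack (rack (x ⊗ₜ[k] y) ⊗ₜ[k] z) =
    rack (TensorProduct.map (rack.toLinearMap ∘ₗ TensorProduct.mk k C C x)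
      (rack.toLinearMap ∘ₗ TensorProduct.mk k C C y) (Coalgebra.comul (R := k) z))
  rack_one : ∀ x : C, rack (x ⊗ₜ[k] one) = x
  one_rack : ∀ x : C, rack (one ⊗ₜ[k] x) = Coalgebra.counit (R := k) x • one

namespace RackBialgebra

open Coalgebra

theorem comul_comul {k : Type u} {C : Type v} [Field k] [AddCommGroup C] [Module k C]
    [Coalgebra k C] [IsCocomm k C] (y : C) : TensorProduct.tensorTensorTensorComm k C C C C
      (TensorProduct.map (comul (R := k)) (comul (R := k)) (comul (R := k) y)) =
    TensorProduct.map (comul (R := k)) (comul (R := k)) (comul (R := k) y) := by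
  have := CoalgHomClass.map_comp_comul_apply (comulCoalgHom k C) y
  exact this.symm

variable (k : Type u) (C : Type v) [Field k] [AddCommGroup C] [Module k C] [Coalgebra k C]

/-- `Č = ker ε` -/
abbrev Aug : Submodule k C := LinearMap.ker (counit (R := k) (A := C))

variable [RackBialgebra k C]

/-- The projection `C → ker ε`, `c ↦ c - ε(c) 1`. -/
def toAug : C →ₗ[k] Aug k C :=
  LinearMap.codRestrict (Aug k C)
    (LinearMap.id - (counit (R := k) (A := C)).smulRight (one k : C)) (by
      intro c
      simp [counit_one])

theorem coe_toAug (c : C) : (toAug k C c : C) = c - counit (R := k) c • (one k : C) := rfl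

theorem toAug_coe (c : Aug k C) : toAug k C c = c := by
  ext
  simp [coe_toAug, LinearMap.mem_ker.mp c.2]

theorem toAug_one : toAug k C (one k) = 0 := by
  ext
  simp [coe_toAug, counit_one]

theorem smul_one_add_toAug (c : C) : counit (R := k) c • (one k : C) + toAug k C c = c := by
  simp [coe_toAug]

/-- The inclusion `i : C → T(ker ε)`: the identity on `ker ε`, and `1 ↦ 1`. -/
def incl : C →ₗ[k] TensorAlgebra k (Aug k C) :=
  (Algebra.linearMap k (TensorAlgebra k (Aug k C))) ∘ₗ counit + TensorAlgebra.ι k ∘ₗ toAug k C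

/-- The defining relations `i(y₁) i(x ◁ y₂) = i(x) i(y)` of `U(C)`. -/
inductive Rel : TensorAlgebra k (Aug k C) → TensorAlgebra k (Aug k C) → Prop
  | mk (x y : C) : Rel
      (LinearMap.mul' k _ (TensorProduct.map (incl k C)
        (incl k C ∘ₗ (rack (k := k) (C := C)).toLinearMap ∘ₗ TensorProduct.mk k C C x)
        (comul (R := k) y)))
      (incl k C x * incl k C y)

/-- The universal enveloping algebra `U(C)`: the quotient of `T(ker ε)` by the two-sided ideal
generated by the relations `Rel`. -/
def Env : Type (max u v) := RingQuot (Rel k C)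

instance : Ring (Env k C) := inferInstanceAs (Ring (RingQuot (Rel k C)))
instance : Algebra k (Env k C) := inferInstanceAs (Algebra k (RingQuot (Rel k C)))

/-- The quotient map. -/
def toEnv : TensorAlgebra k (Aug k C) →ₐ[k] Env k C := RingQuot.mkAlgHom k (Rel k C)

/-- The canonical map `q : C → U(C)`. -/
def q : C →ₗ[k] Env k C := (toEnv k C).toLinearMap ∘ₗ incl k C

theorem q_one : q k C (one k) = 1 := by
  simp [q, incl, counit_one, toAug_one]

theorem q_rel (x y : C) :
    LinearMap.mul' k _ (TensorProduct.map (q k C)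
        (q k C ∘ₗ (rack (k := k) (C := C)).toLinearMap ∘ₗ TensorProduct.mk k C C x)
        (comul (R := k) y)) = q k C x * q k C y := by
  have h := RingQuot.mkAlgHom_rel k (Rel.mk (k := k) (C := C) x y)
  have e : ∀ t : TensorAlgebra k (Aug k C) ⊗[k] TensorAlgebra k (Aug k C),
      toEnv k C (LinearMap.mul' k _ t) = LinearMap.mul' k _
        (TensorProduct.map (toEnv k C).toLinearMap (toEnv k C).toLinearMap t) := by
    intro t
    induction t with
    | zero => simp
    | tmul a b => simp
    | add a b ha hb => simp_all
  have h' : toEnv k C _ = toEnv k C _ := h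
  rw [e, ← LinearMap.comp_apply (TensorProduct.map (toEnv k C).toLinearMap _),
    ← TensorProduct.map_comp, map_mul] at h'
  exact h'

variable {k C} in
/-- Universal property of `U(C)` as an algebra. -/
def lift {A : Type*} [Ring A] [Algebra k A] (f : C →ₗ[k] A) (h1 : f (one k) = 1)
    (hf : ∀ x y : C, LinearMap.mul' k _ (TensorProduct.map f
        (f ∘ₗ (rack (k := k) (C := C)).toLinearMap ∘ₗ TensorProduct.mk k C C x)
        (comul (R := k) y)) = f x * f y) : Env k C →ₐ[k] A :=
  RingQuot.liftAlgHom k ⟨TensorAlgebra.lift k (f ∘ₗ (Aug k C).subtype), by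
    have hi : ∀ c, TensorAlgebra.lift k (f ∘ₗ (Aug k C).subtype) (incl k C c) = f c := by
      intro c
      conv_rhs => rw [← smul_one_add_toAug k C c, map_add, map_smul, h1]
      simp [incl, Algebra.algebraMap_eq_smul_one]
    have hi' : (TensorAlgebra.lift k (f ∘ₗ (Aug k C).subtype)).toLinearMap ∘ₗ incl k C = f :=
      LinearMap.ext hi
    have e : ∀ t : TensorAlgebra k (Aug k C) ⊗[k] TensorAlgebra k (Aug k C),
        TensorAlgebra.lift k (f ∘ₗ (Aug k C).subtype) (LinearMap.mul' k _ t) = LinearMap.mul' k _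
          (TensorProduct.map (TensorAlgebra.lift k (f ∘ₗ (Aug k C).subtype)).toLinearMap
            (TensorAlgebra.lift k (f ∘ₗ (Aug k C).subtype)).toLinearMap t) := by
      intro t
      induction t with
      | zero => simp
      | tmul a b => simp
      | add a b ha hb => simp_all
    rintro _ _ ⟨x, y⟩
    rw [e, ← LinearMap.comp_apply (TensorProduct.map (AlgHom.toLinearMap _) _),
      ← TensorProduct.map_comp, map_mul, hi, hi, ← LinearMap.comp_assoc, hi', hf]⟩

variable {k C} in
theorem lift_q {A : Type*} [Ring A] [Algebra k A] (f : C →ₗ[k] A) (h1 : f (one k) = 1) (hf)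
    (c : C) : lift f h1 hf (q k C c) = f c := by
  have : lift f h1 hf (q k C c) = TensorAlgebra.lift k (f ∘ₗ (Aug k C).subtype) (incl k C c) :=
    RingQuot.liftAlgHom_mkAlgHom_apply ..
  rw [this]
  conv_rhs => rw [← smul_one_add_toAug k C c, map_add, map_smul, h1]
  simp [incl, Algebra.algebraMap_eq_smul_one]

variable {k C} in
theorem algHom_ext {A : Type*} [Ring A] [Algebra k A] {f g : Env k C →ₐ[k] A}
    (h : ∀ c : C, f (q k C c) = g (q k C c)) : f = g := by
  refine RingQuot.ringQuot_ext' (S := k) (s := Rel k C) (f := f) (g := g) (TensorAlgebra.hom_ext (LinearMap.ext fun c => ?_))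
  have := h c
  have hc : incl k C c = TensorAlgebra.ι k c := by
    simp [incl, LinearMap.mem_ker.mp c.2, toAug_coe]
  simp only [q, LinearMap.comp_apply, hc] at this
  exact this

/-- The counit of `U(C)`: the algebra map with `ε(q c) = ε(c)`. -/
def envCounit : Env k C →ₐ[k] k :=
  lift (counit (R := k) (A := C)) counit_one (by
    intro x y
    have : ∀ t : C ⊗[k] C, LinearMap.mul' k _ (TensorProduct.map (counit (R := k) (A := C))
        (counit ∘ₗ (rack (k := k) (C := C)).toLinearMap ∘ₗ TensorProduct.mk k C C x) t) =
        counit (R := k) x * counit (R := k) (TensorProduct.lid k C (TensorProduct.map (counit (R := k) (A := C)) LinearMap.id t)) := by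
      intro t
      induction t with
      | zero => simp
      | tmul a b =>
        simp
        ring
      | add a b ha hb => simp only [map_add, ha, hb, mul_add]
    rw [this]
    have h2 := rTensor_counit_comul (R := k) y
    rw [LinearMap.rTensor] at h2
    simp [h2])


theorem comul_rack (x y : C) : comul (R := k) (rack (k := k) (x ⊗ₜ[k] y)) =
    TensorProduct.map (rack (k := k) (C := C)).toLinearMap (rack (k := k) (C := C)).toLinearMap
      (TensorProduct.tensorTensorTensorComm k C C C C
        (comul (R := k) x ⊗ₜ[k] comul (R := k) y)) := by
  have := CoalgHomClass.map_comp_comul_apply (rack (k := k) (C := C)) (x ⊗ₜ y)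
  exact this.symm

theorem comul_rel_aux (s : C ⊗[k] C) (w : C ⊗[k] C) :
    LinearMap.mul' k (Env k C ⊗[k] Env k C) (TensorProduct.map (TensorProduct.map (q k C) (q k C))
      (TensorProduct.map (q k C) (q k C) ∘ₗ
        TensorProduct.map (rack (k := k) (C := C)).toLinearMap
          (rack (k := k) (C := C)).toLinearMap ∘ₗ
        (TensorProduct.tensorTensorTensorComm k C C C C).toLinearMap ∘ₗ
        TensorProduct.mk k (C ⊗[k] C) (C ⊗[k] C) s)
      (TensorProduct.tensorTensorTensorComm k C C C C
        (TensorProduct.map (comul (R := k)) (comul (R := k)) w))) =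
    TensorProduct.map (q k C) (q k C) s * TensorProduct.map (q k C) (q k C) w := by
  have key : ∀ (a b : C) (u v : C ⊗[k] C),
      LinearMap.mul' k (Env k C ⊗[k] Env k C)
        (TensorProduct.map (TensorProduct.map (q k C) (q k C))
      (TensorProduct.map (q k C) (q k C) ∘ₗ
        TensorProduct.map (rack (k := k) (C := C)).toLinearMap
          (rack (k := k) (C := C)).toLinearMap ∘ₗ
        (TensorProduct.tensorTensorTensorComm k C C C C).toLinearMap ∘ₗ
        TensorProduct.mk k (C ⊗[k] C) (C ⊗[k] C) (a ⊗ₜ b))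
      (TensorProduct.tensorTensorTensorComm k C C C C (u ⊗ₜ v))) =
      LinearMap.mul' k _ (TensorProduct.map (q k C)
        (q k C ∘ₗ (rack (k := k) (C := C)).toLinearMap ∘ₗ TensorProduct.mk k C C a) u) ⊗ₜ
      LinearMap.mul' k _ (TensorProduct.map (q k C)
        (q k C ∘ₗ (rack (k := k) (C := C)).toLinearMap ∘ₗ TensorProduct.mk k C C b) v) := by
    intro a b u v
    induction u with
    | zero => simp
    | add u u' hu hu' => simp only [map_add, TensorProduct.add_tmul, hu, hu']
    | tmul p r =>
      induction v with
      | zero => simp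
      | add u u' hu hu' => simp only [map_add, TensorProduct.tmul_add, hu, hu']
      | tmul p' r' => simp
  induction s with
  | zero =>
    simp only [map_zero, zero_mul, LinearMap.comp_zero, TensorProduct.map_zero_right,
      LinearMap.zero_apply]
  | add s s' hs hs' =>
    simp only [map_add, add_mul, LinearMap.comp_add, TensorProduct.map_add_right,
      LinearMap.add_apply] at hs hs' ⊢
    rw [hs, hs']
  | tmul a b =>
    induction w with
    | zero => simp only [map_zero, mul_zero]
    | add s s' hs hs' => simp only [map_add, mul_add, hs, hs']
    | tmul c d =>
      rw [TensorProduct.map_tmul, key, q_rel, q_rel]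
      simp

theorem envCounit_q (c : C) : envCounit k C (q k C c) = counit (R := k) c :=
  lift_q _ _ _ c


/-- The right action of `U(C)` on `C` with `x · q(c) = x ◁ c`, as an algebra map to the opposite of
`End(C)`. -/
def actHom : Env k C →ₐ[k] (Module.End k C)ᵐᵒᵖ :=
  lift ((MulOpposite.opLinearEquiv k).toLinearMap ∘ₗ
      (TensorProduct.curry (rack (k := k) (C := C)).toLinearMap).flip)
    (by
      apply MulOpposite.unop_injective
      ext x
      simp [rack_one])
    (by
      intro x y
      apply MulOpposite.unop_injective
      ext z
      have h : ∀ t : C ⊗[k] C, (LinearMap.mul' k (Module.End k C)ᵐᵒᵖ (TensorProduct.map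
          ((MulOpposite.opLinearEquiv k).toLinearMap ∘ₗ
            (TensorProduct.curry (rack (k := k) (C := C)).toLinearMap).flip)
          (((MulOpposite.opLinearEquiv k).toLinearMap ∘ₗ
            (TensorProduct.curry (rack (k := k) (C := C)).toLinearMap).flip) ∘ₗ
            (rack (k := k) (C := C)).toLinearMap ∘ₗ TensorProduct.mk k C C x) t)).unop z =
          rack (k := k) (TensorProduct.map
            ((rack (k := k)).toLinearMap ∘ₗ TensorProduct.mk k C C z)
            ((rack (k := k)).toLinearMap ∘ₗ TensorProduct.mk k C C x) t) := by
        intro t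
        induction t with
        | zero => simp
        | add a b ha hb => simp only [map_add, MulOpposite.unop_add, LinearMap.add_apply, ha, hb]
        | tmul a b => simp
      rw [h, ← self_distrib]
      simp)

theorem actHom_q (x c : C) : (actHom k C (q k C c)).unop x = rack (k := k) (x ⊗ₜ[k] c) := by
  simp [actHom, lift_q]

theorem counit_actHom (h : Env k C) (x : C) :
    counit (R := k) ((actHom k C h).unop x) = counit (R := k) x * envCounit k C h := by
  obtain ⟨t, rfl⟩ : ∃ t, toEnv k C t = h := RingQuot.mkAlgHom_surjective k (Rel k C) h
  induction t using TensorAlgebra.induction generalizing x with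
  | algebraMap r => simp [mul_comm]
  | ι c =>
    have hc : toEnv k C (TensorAlgebra.ι k c) = q k C c := by
      simp [q, incl, LinearMap.mem_ker.mp c.2, toAug_coe]
    have := CoalgHomClass.counit_comp_apply (rack (k := k) (C := C)) (x ⊗ₜ (c : C))
    rw [hc, actHom_q, envCounit_q, this]
    simp [mul_comm]
  | mul a b ha hb => simp [ha, hb, mul_assoc]
  | add a b ha hb => simp [ha, hb, mul_add]

/-- The restriction of the right action to `ker ε`. -/
def augAct : Aug k C ⊗[k] Env k C →ₗ[k] Aug k C :=
  LinearMap.codRestrict (Aug k C)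
    (TensorProduct.lift (((MulOpposite.opLinearEquiv k).symm.toLinearMap ∘ₗ
      (actHom k C).toLinearMap).flip ∘ₗ (Aug k C).subtype)) (by
    intro t
    induction t with
    | zero => simp
    | add a b ha hb => rw [map_add]; exact add_mem ha hb
    | tmul x h => simp [counit_actHom])

theorem augAct_apply (x : Aug k C) (h : Env k C) :
    (augAct k C (x ⊗ₜ h) : C) = (actHom k C h).unop x := rfl

section Cocommutative

variable [IsCocomm k C]

/-- The comultiplication of `U(C)`: the algebra map with `Δ(q c) = q c₁ ⊗ q c₂`. -/
def envComul : Env k C →ₐ[k] Env k C ⊗[k] Env k C :=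
  lift (TensorProduct.map (q k C) (q k C) ∘ₗ comul (R := k) (A := C))
    (by simp [comul_one, q_one, Algebra.TensorProduct.one_def]) (by
    intro x y
    have h := comul_rel_aux k C (comul (R := k) x) (comul (R := k) y)
    rw [comul_comul, ← LinearMap.comp_apply (TensorProduct.map (TensorProduct.map _ _) _),
      ← TensorProduct.map_comp] at h
    have e : TensorProduct.map (q k C) (q k C) ∘ₗ comul (R := k) (A := C) ∘ₗ
        (rack (k := k) (C := C)).toLinearMap ∘ₗ TensorProduct.mk k C C x =
        (TensorProduct.map (q k C) (q k C) ∘ₗ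
        TensorProduct.map (rack (k := k) (C := C)).toLinearMap
          (rack (k := k) (C := C)).toLinearMap ∘ₗ
        (TensorProduct.tensorTensorTensorComm k C C C C).toLinearMap ∘ₗ
        TensorProduct.mk k (C ⊗[k] C) (C ⊗[k] C) (comul (R := k) x)) ∘ₗ comul (R := k) :=
      LinearMap.ext fun b => congrArg (TensorProduct.map (q k C) (q k C)) (comul_rack k C x b)
    rw [← e] at h
    exact h)

theorem envComul_q (c : C) :
    envComul k C (q k C c) = TensorProduct.map (q k C) (q k C) (comul (R := k) c) :=
  lift_q _ _ _ c

/-- `U(C)` is a bialgebra when `C` is cocommutative. -/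
instance : Bialgebra k (Env k C) :=
  Bialgebra.ofAlgHom (envComul k C) (envCounit k C)
    (algHom_ext fun c => by
      have h1 : ∀ t : C ⊗[k] C, Algebra.TensorProduct.assoc k k k (Env k C) (Env k C) (Env k C)
          (Algebra.TensorProduct.map (envComul k C) (.id k _) (TensorProduct.map (q k C) (q k C) t))
          = TensorProduct.map (q k C) (TensorProduct.map (q k C) (q k C))
            (TensorProduct.assoc k C C C (TensorProduct.map (comul (R := k)) LinearMap.id t)) := by
        intro t
        induction t with
        | zero => simp
        | add a b ha hb => simp only [map_add, ha, hb]
        | tmul a b =>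
          simp only [TensorProduct.map_tmul, Algebra.TensorProduct.map_tmul, envComul_q,
            AlgHom.id_apply, LinearMap.id_apply]
          induction comul (R := k) a with
          | zero => simp
          | add a b ha hb => simp only [map_add, TensorProduct.add_tmul, ha, hb]
          | tmul a b => simp
      have h2 : ∀ t : C ⊗[k] C, Algebra.TensorProduct.map (.id k _) (envComul k C)
            (TensorProduct.map (q k C) (q k C) t)
          = TensorProduct.map (q k C) (TensorProduct.map (q k C) (q k C))
            (TensorProduct.map LinearMap.id (comul (R := k)) t) := by
        intro t
        induction t with
        | zero => simp
        | add a b ha hb => simp only [map_add, ha, hb]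
        | tmul a b => simp [envComul_q]
      have h3 := coassoc_apply (R := k) c
      rw [LinearMap.rTensor, LinearMap.lTensor] at h3
      simp only [AlgHom.comp_apply, envComul_q]
      rw [h2, ← h3]
      exact h1 _)
    (algHom_ext fun c => by
      have h1 : ∀ t : C ⊗[k] C, Algebra.TensorProduct.map (envCounit k C) (.id k _)
            (TensorProduct.map (q k C) (q k C) t)
          = TensorProduct.map LinearMap.id (q k C)
            (TensorProduct.map (counit (R := k)) LinearMap.id t) := by
        intro t
        induction t with
        | zero => simp
        | add a b ha hb => simp only [map_add, ha, hb]
        | tmul a b => simp [envCounit_q]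
      have h3 := rTensor_counit_comul (R := k) c
      rw [LinearMap.rTensor] at h3
      simp [AlgHom.comp_apply, envComul_q, h1, h3])
    (algHom_ext fun c => by
      have h1 : ∀ t : C ⊗[k] C, Algebra.TensorProduct.map (.id k _) (envCounit k C)
            (TensorProduct.map (q k C) (q k C) t)
          = TensorProduct.map (q k C) LinearMap.id
            (TensorProduct.map LinearMap.id (counit (R := k)) t) := by
        intro t
        induction t with
        | zero => simp
        | add a b ha hb => simp only [map_add, ha, hb]
        | tmul a b => simp [envCounit_q]
      have h3 := lTensor_counit_comul (R := k) c
      rw [LinearMap.lTensor] at h3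
      simp [AlgHom.comp_apply, envComul_q, h1, h3])

end Cocommutative

/-- The right coaction `x ↦ (x₁ - ε(x₁) 1) ⊗ q(x₂)` of `U(C)` on `ker ε`. On `C` the coaction has the
additional summand `ε(x) 1 ⊗ 1`, which vanishes on `ker ε`. -/
def augCoact : Aug k C →ₗ[k] Aug k C ⊗[k] Env k C :=
  TensorProduct.map (toAug k C) (q k C) ∘ₗ comul ∘ₗ (Aug k C).subtype

/-- The map `U(C) ⊗ ker ε → U(C)`, `x ⊗ y ↦ x q(y)`. -/
def envMap : Env k C ⊗[k] Aug k C →ₗ[k] Env k C :=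
  LinearMap.mul' k (Env k C) ∘ₗ TensorProduct.map LinearMap.id (q k C ∘ₗ (Aug k C).subtype)

/-- The same map as an object of the Loday-Pirashvili category. -/
abbrev envLinMap : LinMap.{u, v} k where
  src := Env k C ⊗[k] Aug k C
  tgt := Env k C
  map := envMap k C

end RackBialgebra

end

/-! The theorem splits into two general constructions and one computation in $U$.

First, let $H$ be any bialgebra and $V$ a right module and right comodule over it. On $H\otimes V$
with the given actions and coactions, every tetramodule axiom except one follows from the bialgebra
axioms of $H$ and the module and comodule axioms of $V$. The exception is that the right coaction
respects the right action, which also needs the Yetter–Drinfeld identity $(v g_2)_{(0)}\otimes g_1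
(v g_2)_{(1)} = v_{(0)} g_1\otimes v_{(1)} g_2$ (`IsYetterDrinfeld.isHopfTetramodule`). No antipode
is involved.

Second, let $M$ be a tetramodule over $H$ with a bilinear coderivation $f\colon M\to H$. Then $f$ is
a bialgebra object of $\mathcal{LM}$ (`IsHopfTetramodule.exists_bimonObj`). Bilinearity and the
coderivation rule say that product and coproduct are commutative squares. The degree 1 parts of
associativity, coassociativity and their compatibility are the bimodule, bicomodule and tetramodule
axioms. The counit may vanish in degree 1 because $\epsilon f = 2\,\epsilon f$ forces $\epsilon
f=0$.

It remains to treat $\check C$ over $U$. On a generator $g=q(c)$ the left side of the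
Yetter–Drinfeld identity is $v_1\lhd c_2\otimes q(c_1)q(v_2\lhd c_3)$, up to the projection to
$\check C$ in the first factor, since $\lhd$ is a coalgebra map. By the defining relation of $U$ the
right side is $v_1\lhd c_1\otimes q(c_2)q(v_2\lhd c_3)$. The two agree by cocommutativity
(`augAct_compat_q`), and the identity passes to products in $U$. Right linearity of $f$ is the
defining relation extended from generators to $U$ (`mul_q_augAct`). The coderivation rule comes from
$\triangle q(v)=1\otimes q(v)+q(v_{(0)})\otimes v_{(1)}$ on $\check C$. -/

noncomputable section

/-! ### Tetramodules $H\otimes V$ from Yetter–Drinfeld modules $V$ -/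

section YetterDrinfeld

open Coalgebra

variable {k H V : Type*} [Field k] [Ring H] [Bialgebra k H] [AddCommGroup V] [Module k V]

theorem leftAct_tmul (g h : H) (v : V) : leftAct k H V (g ⊗ₜ (h ⊗ₜ v)) = (g * h) ⊗ₜ v := by
  simp [leftAct]

theorem leftCoact_tmul (h : H) (v : V) : leftCoact k H V (h ⊗ₜ v) =
    TensorProduct.assoc k H H V (comul (R := k) h ⊗ₜ v) := by
  simp [leftCoact]

theorem rightAct_tmul (act : V ⊗[k] H →ₗ[k] V) (h g : H) (v : V) :
    rightAct act ((h ⊗ₜ v) ⊗ₜ g) =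
      TensorProduct.map (LinearMap.mulLeft k h) (act ∘ₗ TensorProduct.mk k V H v)
        (comul (R := k) g) := by
  simp only [rightAct, LinearMap.comp_apply, TensorProduct.map_tmul, LinearMap.id_apply,
    LinearEquiv.coe_coe]
  induction comul (R := k) g with
  | zero => simp
  | add a b ha hb => simp only [map_add, TensorProduct.tmul_add, ha, hb]
  | tmul a b => simp

theorem rightCoact_tmul (coact : V →ₗ[k] V ⊗[k] H) (h : H) (v : V) :
    rightCoact coact (h ⊗ₜ v) = TensorProduct.map LinearMap.id (LinearMap.mul' k H)
      (TensorProduct.tensorTensorTensorComm k H H V H (comul (R := k) h ⊗ₜ coact v)) := by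
  simp [rightCoact]

/-- `a ⊗ b ↦ (v · b)₍₀₎ ⊗ a (v · b)₍₁₎` -/
def twistedCoact (act : V ⊗[k] H →ₗ[k] V) (coact : V →ₗ[k] V ⊗[k] H) (v : V) :
    H ⊗[k] H →ₗ[k] V ⊗[k] H :=
  TensorProduct.lift (LinearMap.lcomp k (V ⊗[k] H) (coact ∘ₗ act ∘ₗ TensorProduct.mk k V H v) ∘ₗ
    LinearMap.lTensorHom V ∘ₗ LinearMap.mul k H)

theorem twistedCoact_tmul (act : V ⊗[k] H →ₗ[k] V) (coact : V →ₗ[k] V ⊗[k] H) (v : V) (a b : H) :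
    twistedCoact act coact v (a ⊗ₜ b) =
      (LinearMap.mulLeft k a).lTensor V (coact (act (v ⊗ₜ b))) := rfl

/-- The diagonal right action of `H` on `V ⊗ H`. -/
def diagAct (act : V ⊗[k] H →ₗ[k] V) : (V ⊗[k] H) ⊗[k] (H ⊗[k] H) →ₗ[k] V ⊗[k] H :=
  TensorProduct.map act (LinearMap.mul' k H) ∘ₗ
    (TensorProduct.tensorTensorTensorComm k V H H H).toLinearMap

theorem diagAct_tmul (act : V ⊗[k] H →ₗ[k] V) (v : V) (a b c : H) :
    diagAct act ((v ⊗ₜ a) ⊗ₜ (b ⊗ₜ c)) = act (v ⊗ₜ b) ⊗ₜ (a * c) := rfl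

/-- A right module and right comodule `V` over `H` with
`(v · g₂)₍₀₎ ⊗ g₁ (v · g₂)₍₁₎ = v₍₀₎ · g₁ ⊗ v₍₁₎ g₂`. -/
structure IsYetterDrinfeld (act : V ⊗[k] H →ₗ[k] V) (coact : V →ₗ[k] V ⊗[k] H) : Prop where
  act_one : ∀ v, act (v ⊗ₜ 1) = v
  act_mul : ∀ v g h, act (v ⊗ₜ (g * h)) = act (act (v ⊗ₜ g) ⊗ₜ h)
  coact_counit : ∀ v, TensorProduct.rid k V ((counit (R := k) (A := H)).lTensor V (coact v)) = v
  coact_comul : ∀ v, TensorProduct.assoc k V H H (coact.rTensor H (coact v)) =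
    (comul (R := k) (A := H)).lTensor V (coact v)
  compat : ∀ v g, twistedCoact act coact v (comul (R := k) g) =
    diagAct act (coact v ⊗ₜ comul (R := k) g)

variable {act : V ⊗[k] H →ₗ[k] V} {coact : V →ₗ[k] V ⊗[k] H}

namespace IsYetterDrinfeld

theorem ract_one (hV : IsYetterDrinfeld act coact) (m : H ⊗[k] V) :
    rightAct act (m ⊗ₜ 1) = m := by
  induction m with
  | zero => simp
  | add a b ha hb => rw [TensorProduct.add_tmul, map_add, ha, hb]
  | tmul h v => simp [rightAct_tmul, Algebra.TensorProduct.one_def, hV.act_one]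

theorem ract_mul (hV : IsYetterDrinfeld act coact) (m : H ⊗[k] V) (g h : H) :
    rightAct act (m ⊗ₜ (g * h)) = rightAct act (rightAct act (m ⊗ₜ g) ⊗ₜ h) := by
  induction m with
  | zero => simp
  | add a b ha hb => simp only [TensorProduct.add_tmul, map_add, ha, hb]
  | tmul x v =>
    rw [rightAct_tmul, rightAct_tmul, Bialgebra.comul_mul]
    induction comul (R := k) g with
    | zero => simp
    | add a b ha hb => simp only [TensorProduct.add_tmul, map_add, ha, hb, add_mul]
    | tmul a b =>
      simp only [TensorProduct.map_tmul, LinearMap.mulLeft_apply, LinearMap.comp_apply,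
        TensorProduct.mk_apply, rightAct_tmul]
      induction comul (R := k) h with
      | zero => simp
      | add a b ha hb => simp only [map_add, ha, hb, mul_add]
      | tmul c d => simp [hV.act_mul]

theorem lact_ract (g : H) (m : H ⊗[k] V) (h : H) :
    rightAct act (leftAct k H V (g ⊗ₜ m) ⊗ₜ h) = leftAct k H V (g ⊗ₜ rightAct act (m ⊗ₜ h)) := by
  induction m with
  | zero => simp
  | add a b ha hb => simp only [TensorProduct.add_tmul, TensorProduct.tmul_add, map_add, ha, hb]
  | tmul x v =>
    rw [leftAct_tmul, rightAct_tmul, rightAct_tmul]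
    induction comul (R := k) h with
    | zero => simp
    | add a b ha hb => simp only [TensorProduct.tmul_add, map_add, ha, hb]
    | tmul a b => simp [leftAct_tmul]

theorem counit_lcoact (m : H ⊗[k] V) : TensorProduct.lid k (H ⊗[k] V)
    ((counit (R := k) (A := H)).rTensor (H ⊗[k] V) (leftCoact k H V m)) = m := by
  induction m with
  | zero => simp
  | add a b ha hb => simp only [map_add, ha, hb]
  | tmul x v =>
    rw [leftCoact_tmul]
    -- Both sides are linear in the coproduct, so it is replaced by an arbitrary tensor `t` and
    -- checked on pure tensors; the coalgebra axiom is applied only afterwards. The proofs below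
    -- follow the same pattern, with a linear map `F` that receives the iterated coproducts.
    have e : ∀ t : H ⊗[k] H, TensorProduct.lid k (H ⊗[k] V)
        ((counit (R := k) (A := H)).rTensor (H ⊗[k] V) (TensorProduct.assoc k H H V (t ⊗ₜ v))) =
        (TensorProduct.lid k H ((counit (R := k) (A := H)).rTensor H t)) ⊗ₜ v := by
      intro t
      induction t with
      | zero => simp
      | add a b ha hb => simp only [TensorProduct.add_tmul, map_add, ha, hb]
      | tmul a b => simp [TensorProduct.smul_tmul']
    rw [e, rTensor_counit_comul]
    simp

theorem comul_lcoact (m : H ⊗[k] V) : TensorProduct.assoc k H H (H ⊗[k] V)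
    ((comul (R := k) (A := H)).rTensor (H ⊗[k] V) (leftCoact k H V m)) =
      (leftCoact k H V).lTensor H (leftCoact k H V m) := by
  induction m with
  | zero => simp
  | add a b ha hb => simp only [map_add, ha, hb]
  | tmul x v =>
    rw [leftCoact_tmul]
    let F : H ⊗[k] (H ⊗[k] H) →ₗ[k] H ⊗[k] (H ⊗[k] (H ⊗[k] V)) :=
      ((TensorProduct.mk k H V).flip v |>.lTensor H).lTensor H
    have e1 : ∀ t : H ⊗[k] H, TensorProduct.assoc k H H (H ⊗[k] V)
        ((comul (R := k) (A := H)).rTensor (H ⊗[k] V) (TensorProduct.assoc k H H V (t ⊗ₜ v))) =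
        F (TensorProduct.assoc k H H H ((comul (R := k) (A := H)).rTensor H t)) := by
      intro t
      induction t with
      | zero => simp
      | add a b ha hb => simp only [TensorProduct.add_tmul, map_add, ha, hb]
      | tmul a b =>
        simp only [TensorProduct.assoc_tmul, LinearMap.rTensor_tmul]
        induction comul (R := k) a with
        | zero => simp
        | add a b ha hb => simp only [TensorProduct.add_tmul, map_add, ha, hb]
        | tmul a b => simp [F]
    have e2 : ∀ t : H ⊗[k] H,
        (leftCoact k H V).lTensor H (TensorProduct.assoc k H H V (t ⊗ₜ v)) =
        F ((comul (R := k) (A := H)).lTensor H t) := by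
      intro t
      induction t with
      | zero => simp
      | add a b ha hb => simp only [TensorProduct.add_tmul, map_add, ha, hb]
      | tmul a b =>
        simp only [TensorProduct.assoc_tmul, LinearMap.lTensor_tmul, leftCoact_tmul]
        induction comul (R := k) b with
        | zero => simp
        | add a b ha hb =>
          simp only [TensorProduct.add_tmul, TensorProduct.tmul_add, map_add, ha, hb]
        | tmul a b => simp [F]
    rw [e1, e2, coassoc_apply]

theorem rcoact_counit (hV : IsYetterDrinfeld act coact) (m : H ⊗[k] V) :
    TensorProduct.rid k (H ⊗[k] V)
      ((counit (R := k) (A := H)).lTensor (H ⊗[k] V) (rightCoact coact m)) = m := by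
  induction m with
  | zero => simp
  | add a b ha hb => simp only [map_add, ha, hb]
  | tmul x v =>
    rw [rightCoact_tmul]
    have e : ∀ (t : H ⊗[k] H) (s : V ⊗[k] H), TensorProduct.rid k (H ⊗[k] V)
        ((counit (R := k) (A := H)).lTensor (H ⊗[k] V)
          (TensorProduct.map LinearMap.id (LinearMap.mul' k H)
            (TensorProduct.tensorTensorTensorComm k H H V H (t ⊗ₜ s)))) =
        (TensorProduct.rid k H ((counit (R := k) (A := H)).lTensor H t)) ⊗ₜ
          (TensorProduct.rid k V ((counit (R := k) (A := H)).lTensor V s)) := by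
      intro t s
      induction t with
      | zero => simp
      | add a b ha hb => simp only [TensorProduct.add_tmul, map_add, ha, hb]
      | tmul a b =>
        induction s with
        | zero => simp
        | add a b ha hb => simp only [TensorProduct.tmul_add, map_add, ha, hb]
        | tmul c d =>
          simp [TensorProduct.smul_tmul', TensorProduct.tmul_smul, mul_smul]
          rw [smul_comm]
    rw [e, lTensor_counit_comul, hV.coact_counit]
    simp

theorem rcoact_comul (hV : IsYetterDrinfeld act coact) (m : H ⊗[k] V) :
    TensorProduct.assoc k (H ⊗[k] V) H H ((rightCoact coact).rTensor H (rightCoact coact m)) =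
      (comul (R := k) (A := H)).lTensor (H ⊗[k] V) (rightCoact coact m) := by
  induction m with
  | zero => simp
  | add a b ha hb => simp only [map_add, ha, hb]
  | tmul x v =>
    -- `F` sends $x_1\otimes x_2\otimes x_3$ and $v_0\otimes v_1\otimes v_2$ to $(x_1\otimes
    -- v_0)\otimes(x_2v_1\otimes x_3v_2)$. The two sides differ only in the bracketing of the
    -- iterated coproduct of `x` and the iterated coaction of `v`.
    let F : (H ⊗[k] (H ⊗[k] H)) ⊗[k] (V ⊗[k] (H ⊗[k] H)) →ₗ[k] (H ⊗[k] V) ⊗[k] (H ⊗[k] H) :=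
      TensorProduct.map LinearMap.id (LinearMap.mul' k (H ⊗[k] H)) ∘ₗ
        (TensorProduct.tensorTensorTensorComm k H (H ⊗[k] H) V (H ⊗[k] H)).toLinearMap
    have e1 : ∀ (t : H ⊗[k] H) (s : V ⊗[k] H),
        TensorProduct.assoc k (H ⊗[k] V) H H ((rightCoact coact).rTensor H
          (TensorProduct.map LinearMap.id (LinearMap.mul' k H)
            (TensorProduct.tensorTensorTensorComm k H H V H (t ⊗ₜ s)))) =
        F ((TensorProduct.assoc k H H H ((comul (R := k) (A := H)).rTensor H t)) ⊗ₜ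
          (TensorProduct.assoc k V H H (coact.rTensor H s))) := by
      intro t s
      induction t with
      | zero => simp
      | add a b ha hb => simp only [TensorProduct.add_tmul, map_add, ha, hb]
      | tmul a b =>
        induction s with
        | zero => simp
        | add a b ha hb => simp only [TensorProduct.tmul_add, map_add, ha, hb]
        | tmul c d =>
          simp only [TensorProduct.tensorTensorTensorComm_tmul, TensorProduct.map_tmul,
            LinearMap.rTensor_tmul, LinearMap.id_apply, rightCoact_tmul]
          induction comul (R := k) a with
          | zero => simp
          | add a b ha hb => simp only [TensorProduct.add_tmul, map_add, ha, hb]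
          | tmul a b =>
            induction coact c with
            | zero => simp
            | add a b ha hb =>
              simp only [TensorProduct.tmul_add, TensorProduct.add_tmul, map_add, ha, hb]
            | tmul c d => simp [F]
    have e2 : ∀ (t : H ⊗[k] H) (s : V ⊗[k] H),
        (comul (R := k) (A := H)).lTensor (H ⊗[k] V)
          (TensorProduct.map LinearMap.id (LinearMap.mul' k H)
            (TensorProduct.tensorTensorTensorComm k H H V H (t ⊗ₜ s))) =
        F (((comul (R := k) (A := H)).lTensor H t) ⊗ₜ
          ((comul (R := k) (A := H)).lTensor V s)) := by
      intro t s
      induction t with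
      | zero => simp
      | add a b ha hb => simp only [TensorProduct.add_tmul, map_add, ha, hb]
      | tmul a b =>
        induction s with
        | zero => simp
        | add a b ha hb => simp only [TensorProduct.tmul_add, map_add, ha, hb]
        | tmul c d => simp [F]
    rw [rightCoact_tmul, e1, e2, coassoc_apply, hV.coact_comul]

/-- Both sides equal $x_1\otimes(x_2\otimes v_{(0)})\otimes x_3v_{(1)}$, so coassociativity of `H`
suffices and `coact` may be any linear map. -/
theorem lcoact_rcoact (m : H ⊗[k] V) :
    TensorProduct.assoc k H (H ⊗[k] V) H ((leftCoact k H V).rTensor H (rightCoact coact m)) =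
      (rightCoact coact).lTensor H (leftCoact k H V m) := by
  induction m with
  | zero => simp
  | add a b ha hb => simp only [map_add, ha, hb]
  | tmul x v =>
    let F : (H ⊗[k] (H ⊗[k] H)) ⊗[k] (V ⊗[k] H) →ₗ[k] H ⊗[k] ((H ⊗[k] V) ⊗[k] H) :=
      (TensorProduct.map LinearMap.id (LinearMap.mul' k H) ∘ₗ
        (TensorProduct.tensorTensorTensorComm k H H V H).toLinearMap).lTensor H ∘ₗ
        (TensorProduct.assoc k H (H ⊗[k] H) (V ⊗[k] H)).toLinearMap
    have e1 : ∀ (t : H ⊗[k] H) (s : V ⊗[k] H),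
        TensorProduct.assoc k H (H ⊗[k] V) H ((leftCoact k H V).rTensor H
          (TensorProduct.map LinearMap.id (LinearMap.mul' k H)
            (TensorProduct.tensorTensorTensorComm k H H V H (t ⊗ₜ s)))) =
        F ((TensorProduct.assoc k H H H ((comul (R := k) (A := H)).rTensor H t)) ⊗ₜ s) := by
      intro t s
      induction t with
      | zero => simp
      | add a b ha hb => simp only [TensorProduct.add_tmul, map_add, ha, hb]
      | tmul a b =>
        induction s with
        | zero => simp
        | add a b ha hb => simp only [TensorProduct.tmul_add, map_add, ha, hb]
        | tmul c d =>
          simp only [TensorProduct.tensorTensorTensorComm_tmul, TensorProduct.map_tmul,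
            LinearMap.rTensor_tmul, LinearMap.id_apply, leftCoact_tmul]
          induction comul (R := k) a with
          | zero => simp
          | add a b ha hb => simp only [TensorProduct.add_tmul, map_add, ha, hb]
          | tmul a b => simp [F]
    have e2 : ∀ t : H ⊗[k] H,
        (rightCoact coact).lTensor H (TensorProduct.assoc k H H V (t ⊗ₜ v)) =
        F ((comul (R := k) (A := H)).lTensor H t ⊗ₜ coact v) := by
      intro t
      induction t with
      | zero => simp
      | add a b ha hb => simp only [TensorProduct.add_tmul, map_add, ha, hb]
      | tmul a b => simp [F, rightCoact_tmul]
    rw [rightCoact_tmul, leftCoact_tmul, e1, e2, coassoc_apply]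

theorem lcoact_lact (h : H) (m : H ⊗[k] V) : leftCoact k H V (leftAct k H V (h ⊗ₜ m)) =
    TensorProduct.map (LinearMap.mul' k H) (leftAct k H V)
      (TensorProduct.tensorTensorTensorComm k H H H (H ⊗[k] V)
        (comul (R := k) h ⊗ₜ leftCoact k H V m)) := by
  induction m with
  | zero => simp
  | add a b ha hb => simp only [TensorProduct.tmul_add, map_add, ha, hb]
  | tmul x v =>
    rw [leftAct_tmul, leftCoact_tmul, leftCoact_tmul, Bialgebra.comul_mul]
    induction comul (R := k) h with
    | zero => simp
    | add a b ha hb => simp only [TensorProduct.add_tmul, map_add, ha, hb, add_mul]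
    | tmul a b =>
      induction comul (R := k) x with
      | zero => simp
      | add a b ha hb =>
        simp only [TensorProduct.add_tmul, TensorProduct.tmul_add, map_add, ha, hb, mul_add]
      | tmul c d => simp [leftAct_tmul]

theorem rcoact_lact (h : H) (m : H ⊗[k] V) : rightCoact coact (leftAct k H V (h ⊗ₜ m)) =
    TensorProduct.map (leftAct k H V) (LinearMap.mul' k H)
      (TensorProduct.tensorTensorTensorComm k H H (H ⊗[k] V) H
        (comul (R := k) h ⊗ₜ rightCoact coact m)) := by
  induction m with
  | zero => simp
  | add a b ha hb => simp only [TensorProduct.tmul_add, map_add, ha, hb]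
  | tmul x v =>
    rw [leftAct_tmul, rightCoact_tmul, rightCoact_tmul, Bialgebra.comul_mul]
    induction comul (R := k) h with
    | zero => simp
    | add a b ha hb => simp only [TensorProduct.add_tmul, map_add, ha, hb, add_mul]
    | tmul a b =>
      induction comul (R := k) x with
      | zero => simp
      | add a b ha hb =>
        simp only [TensorProduct.add_tmul, TensorProduct.tmul_add, map_add, ha, hb, mul_add]
      | tmul c d =>
        induction coact v with
        | zero => simp
        | add a b ha hb => simp only [TensorProduct.tmul_add, map_add, ha, hb]
        | tmul v w => simp [leftAct_tmul, mul_assoc]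

theorem lcoact_ract (m : H ⊗[k] V) (g : H) : leftCoact k H V (rightAct act (m ⊗ₜ g)) =
    TensorProduct.map (LinearMap.mul' k H) (rightAct act)
      (TensorProduct.tensorTensorTensorComm k H (H ⊗[k] V) H H
        (leftCoact k H V m ⊗ₜ comul (R := k) g)) := by
  induction m with
  | zero => simp
  | add a b ha hb => simp only [TensorProduct.add_tmul, map_add, ha, hb]
  | tmul x v =>
    -- The common value is $x_1g_1\otimes(x_2g_2\otimes v\cdot g_3)$.
    let F : (H ⊗[k] H) ⊗[k] (H ⊗[k] (H ⊗[k] H)) →ₗ[k] H ⊗[k] (H ⊗[k] V) :=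
      TensorProduct.map (LinearMap.mul' k H)
        (TensorProduct.map (LinearMap.mul' k H) (act ∘ₗ TensorProduct.mk k V H v) ∘ₗ
          (TensorProduct.assoc k H H H).symm.toLinearMap) ∘ₗ
        (TensorProduct.tensorTensorTensorComm k H H H (H ⊗[k] H)).toLinearMap
    have e1 : ∀ t : H ⊗[k] H, leftCoact k H V
        (TensorProduct.map (LinearMap.mulLeft k x) (act ∘ₗ TensorProduct.mk k V H v) t) =
        F (comul (R := k) x ⊗ₜ
          TensorProduct.assoc k H H H ((comul (R := k) (A := H)).rTensor H t)) := by
      intro t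
      induction t with
      | zero => simp
      | add a b ha hb => simp only [TensorProduct.tmul_add, map_add, ha, hb]
      | tmul a b =>
        simp only [TensorProduct.map_tmul, LinearMap.mulLeft_apply, leftCoact_tmul,
          Bialgebra.comul_mul, LinearMap.rTensor_tmul]
        induction comul (R := k) x with
        | zero => simp
        | add a b ha hb => simp only [TensorProduct.add_tmul, map_add, ha, hb, add_mul]
        | tmul p r =>
          induction comul (R := k) a with
          | zero => simp
          | add a b ha hb =>
            simp only [TensorProduct.add_tmul, TensorProduct.tmul_add, map_add, ha, hb, mul_add]
          | tmul c d => simp [F]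
    have e2 : ∀ t : H ⊗[k] H, TensorProduct.map (LinearMap.mul' k H) (rightAct act)
        (TensorProduct.tensorTensorTensorComm k H (H ⊗[k] V) H H
          (TensorProduct.assoc k H H V (comul (R := k) x ⊗ₜ v) ⊗ₜ t)) =
        F (comul (R := k) x ⊗ₜ (comul (R := k) (A := H)).lTensor H t) := by
      intro t
      induction t with
      | zero => simp
      | add a b ha hb => simp only [TensorProduct.tmul_add, map_add, ha, hb]
      | tmul a b =>
        induction comul (R := k) x with
        | zero => simp
        | add a b ha hb => simp only [TensorProduct.add_tmul, map_add, ha, hb]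
        | tmul p r =>
          simp only [TensorProduct.assoc_tmul, TensorProduct.tensorTensorTensorComm_tmul,
            TensorProduct.map_tmul, rightAct_tmul, LinearMap.lTensor_tmul]
          induction comul (R := k) b with
          | zero => simp
          | add a b ha hb => simp only [TensorProduct.tmul_add, map_add, ha, hb]
          | tmul c d => simp [F]
    rw [rightAct_tmul, leftCoact_tmul, e1, e2, coassoc_apply]

/-- The only axiom that needs `compat`. The left side is $(x_1g_1\otimes (v g_3)_{(0)})\otimes
x_2g_2(v g_3)_{(1)}$ and the right side is $(x_1g_1\otimes v_{(0)}g_2)\otimes x_2v_{(1)}g_3$;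
`compat` is applied to the last two legs of the iterated coproduct of $g$. -/
theorem rcoact_ract (hV : IsYetterDrinfeld act coact) (m : H ⊗[k] V) (g : H) :
    rightCoact coact (rightAct act (m ⊗ₜ g)) =
      TensorProduct.map (rightAct act) (LinearMap.mul' k H)
        (TensorProduct.tensorTensorTensorComm k (H ⊗[k] V) H H H
          (rightCoact coact m ⊗ₜ comul (R := k) g)) := by
  induction m with
  | zero => simp
  | add a b ha hb => simp only [TensorProduct.add_tmul, map_add, ha, hb]
  | tmul x v =>
    -- `F` sends $(p\otimes r)\otimes(c\otimes(w\otimes z))$ to $(pc\otimes w)\otimes rz$.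
    let F : (H ⊗[k] H) ⊗[k] (H ⊗[k] (V ⊗[k] H)) →ₗ[k] (H ⊗[k] V) ⊗[k] H :=
      (TensorProduct.assoc k H V H).symm.toLinearMap ∘ₗ
        TensorProduct.map (LinearMap.mul' k H)
          ((LinearMap.mul' k H).lTensor V ∘ₗ (TensorProduct.leftComm k H V H).toLinearMap) ∘ₗ
        (TensorProduct.tensorTensorTensorComm k H H H (V ⊗[k] H)).toLinearMap
    have e1 : ∀ t : H ⊗[k] H, rightCoact coact
        (TensorProduct.map (LinearMap.mulLeft k x) (act ∘ₗ TensorProduct.mk k V H v) t) =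
        F (comul (R := k) x ⊗ₜ (twistedCoact act coact v).lTensor H
          (TensorProduct.assoc k H H H ((comul (R := k) (A := H)).rTensor H t))) := by
      intro t
      induction t with
      | zero => simp
      | add a b ha hb => simp only [TensorProduct.tmul_add, map_add, ha, hb]
      | tmul a b =>
        simp only [TensorProduct.map_tmul, LinearMap.mulLeft_apply, rightCoact_tmul,
          Bialgebra.comul_mul, LinearMap.rTensor_tmul]
        induction comul (R := k) x with
        | zero => simp
        | add a b ha hb => simp only [TensorProduct.add_tmul, map_add, ha, hb, add_mul]
        | tmul p r =>
          induction comul (R := k) a with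
          | zero => simp
          | add a b ha hb =>
            simp only [TensorProduct.add_tmul, TensorProduct.tmul_add, map_add, ha, hb, mul_add]
          | tmul c d =>
            simp only [TensorProduct.assoc_tmul, LinearMap.lTensor_tmul, twistedCoact_tmul,
              LinearMap.comp_apply, TensorProduct.mk_apply]
            induction coact (act (v ⊗ₜ b)) with
            | zero => simp
            | add a b ha hb => simp only [TensorProduct.tmul_add, map_add, ha, hb]
            | tmul w z => simp [F, mul_assoc]
    have e2 : ∀ t : H ⊗[k] H, TensorProduct.map (rightAct act) (LinearMap.mul' k H)
        (TensorProduct.tensorTensorTensorComm k (H ⊗[k] V) H H H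
          (TensorProduct.map LinearMap.id (LinearMap.mul' k H)
            (TensorProduct.tensorTensorTensorComm k H H V H (comul (R := k) x ⊗ₜ coact v)) ⊗ₜ t)) =
        F (comul (R := k) x ⊗ₜ (diagAct act ∘ₗ TensorProduct.mk k _ _ (coact v)).lTensor H
          (TensorProduct.assoc k H H H ((comul (R := k) (A := H)).rTensor H t))) := by
      intro t
      induction t with
      | zero => simp
      | add a b ha hb => simp only [TensorProduct.tmul_add, map_add, ha, hb]
      | tmul a b =>
        simp only [LinearMap.rTensor_tmul]
        induction comul (R := k) x with
        | zero => simp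
        | add a b ha hb => simp only [TensorProduct.add_tmul, map_add, ha, hb]
        | tmul p r =>
          induction coact v with
          | zero => simp
          | add a b ha hb =>
            simp only [TensorProduct.add_tmul, TensorProduct.tmul_add, map_add, ha, hb,
              LinearMap.comp_add, LinearMap.lTensor_add, LinearMap.add_apply]
          | tmul v w =>
            simp only [TensorProduct.tensorTensorTensorComm_tmul,
              TensorProduct.map_tmul, LinearMap.id_apply, rightAct_tmul]
            induction comul (R := k) a with
            | zero => simp
            | add a b ha hb =>
              simp only [TensorProduct.add_tmul, TensorProduct.tmul_add, map_add, ha, hb]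
            | tmul c d => simp [F, diagAct_tmul, mul_assoc]
    have e3 : twistedCoact act coact v ∘ₗ comul (R := k) =
        (diagAct act ∘ₗ TensorProduct.mk k _ _ (coact v)) ∘ₗ comul (R := k) :=
      LinearMap.ext (hV.compat v)
    rw [rightAct_tmul, rightCoact_tmul, e1, e2, coassoc_apply, ← LinearMap.lTensor_comp_apply,
      ← LinearMap.lTensor_comp_apply, e3]

theorem isHopfTetramodule (hV : IsYetterDrinfeld act coact) :
    IsHopfTetramodule (leftAct k H V) (rightAct act) (leftCoact k H V) (rightCoact coact) where
  one_lact m := by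
    induction m with
    | zero => simp
    | add a b ha hb => simp only [TensorProduct.tmul_add, map_add, ha, hb]
    | tmul h v => simp [leftAct_tmul]
  mul_lact g h m := by
    induction m with
    | zero => simp
    | add a b ha hb => simp only [TensorProduct.tmul_add, map_add, ha, hb]
    | tmul h v => simp [leftAct_tmul, mul_assoc]
  ract_one := hV.ract_one
  ract_mul := hV.ract_mul
  lact_ract := lact_ract
  counit_lcoact := counit_lcoact
  comul_lcoact := comul_lcoact
  rcoact_counit := hV.rcoact_counit
  rcoact_comul := hV.rcoact_comul
  lcoact_rcoact := lcoact_rcoact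
  lcoact_lact := lcoact_lact
  lcoact_ract := lcoact_ract
  rcoact_lact := rcoact_lact
  rcoact_ract := hV.rcoact_ract

end IsYetterDrinfeld

end YetterDrinfeld

/-! ### The middle four exchange in the Loday–Pirashvili category -/

section BimonoidObject

open CategoryTheory MonoidalCategory Coalgebra

variable {k : Type u} [Field k]

namespace LinMap

/-- Inverse associators contain this inverse distributivity map; the formula makes `midExchange`
computable on each summand. -/
theorem prodLeft_symm_pair {A B D : Type*} [AddCommGroup A] [Module k A] [AddCommGroup B]
    [Module k B] [AddCommGroup D] [Module k D] (p : (A ⊗[k] D) × (B ⊗[k] D)) :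
    (TensorProduct.prodLeft k k A B D).symm p =
      TensorProduct.map (LinearMap.inl k A B) LinearMap.id p.1 +
        TensorProduct.map (LinearMap.inr k A B) LinearMap.id p.2 := by
  rw [LinearEquiv.symm_apply_eq]
  have h : ∀ (x : A ⊗[k] D) (y : B ⊗[k] D), TensorProduct.prodLeft k k A B D
      (TensorProduct.map (LinearMap.inl k A B) LinearMap.id x +
        TensorProduct.map (LinearMap.inr k A B) LinearMap.id y) = (x, y) := by
    intro x y
    rw [map_add]
    have h1 : TensorProduct.prodLeft k k A B D
        (TensorProduct.map (LinearMap.inl k A B) LinearMap.id x) = (x, 0) := by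
      induction x with
      | zero => simp only [map_zero]; rfl
      | add a b ha hb => simp only [map_add, ha, hb, Prod.mk_add_mk, add_zero]
      | tmul a b => simp
    have h2 : TensorProduct.prodLeft k k A B D
        (TensorProduct.map (LinearMap.inr k A B) LinearMap.id y) = (0, y) := by
      induction y with
      | zero => simp only [map_zero]; rfl
      | add a b ha hb => simp only [map_add, ha, hb, Prod.mk_add_mk, add_zero]
      | tmul a b => simp
    rw [h1, h2, Prod.mk_add_mk, add_zero, zero_add]
  exact (h p.1 p.2).symm

theorem prodAssoc_symm_mk {A B D : Type*} [AddCommGroup A] [Module k A] [AddCommGroup B]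
    [Module k B] [AddCommGroup D] [Module k D] (a : A) (b : B) (d : D) :
    (LinearEquiv.prodAssoc k A B D).symm (a, b, d) = ((a, b), d) := rfl

/-- The morphism `(0 → k) ⟶ X` given by an element of the target of `X`. -/
def unitTo (X : LinMap.{u, v} k) (x : X.tgt) : unit k ⟶ X where
  src := 0
  tgt := (LinearMap.toSpanSingleton k X.tgt x) ∘ₗ
    (ULift.moduleEquiv : ULift.{v} k ≃ₗ[k] k).toLinearMap
  comm := by simp

/-- The morphism `X ⟶ (0 → k)` given by a linear form that vanishes on the image of `X`. -/
def toUnit (X : LinMap.{u, v} k) (e : X.tgt →ₗ[k] k) (h : e ∘ₗ X.map = 0) : X ⟶ unit k where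
  src := 0
  tgt := (ULift.moduleEquiv : ULift.{v} k ≃ₗ[k] k).symm.toLinearMap ∘ₗ e
  comm := by rw [LinearMap.comp_assoc, h]; simp

/-- The middle four exchange in terms of `assoc` and `braid`. -/
def midExchange (X Y Z W : LinMap.{u, v} k) :
    tensor (tensor X Y) (tensor Z W) ⟶ tensor (tensor X Z) (tensor Y W) :=
  (assoc X Y (tensor Z W)).hom ≫ tensorMap (𝟙 X) (assoc Y Z W).inv ≫
    tensorMap (𝟙 X) (tensorMap (braid Y Z).hom (𝟙 W)) ≫
      tensorMap (𝟙 X) (assoc Z Y W).hom ≫ (assoc X Z (tensor Y W)).inv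

theorem midExchange_tgt (X Y Z W : LinMap.{u, v} k) : (midExchange X Y Z W).tgt =
    (TensorProduct.tensorTensorTensorComm k X.tgt Y.tgt Z.tgt W.tgt).toLinearMap := by
  ext
  simp [midExchange, assoc, braid]

/-- In degree 1 exactly one of the four factors has degree 1, and the exchange permutes these four
summands. Those with `X` or `Z` in degree 1 land in the first component, those with `Y` or `W` in
the second. This is the case of `X` and `Y`; `midExchange_src_inr` is that of `Z` and `W`. -/
theorem midExchange_src_inl (X Y Z W : LinMap.{u, v} k) (w : X.src ⊗[k] Y.tgt)
    (w' : X.tgt ⊗[k] Y.src) (t : Z.tgt ⊗[k] W.tgt) :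
    (midExchange X Y Z W).src ((w, w') ⊗ₜ t, 0) =
      (TensorProduct.map (LinearMap.inl k _ _) LinearMap.id
        (TensorProduct.tensorTensorTensorComm k X.src Y.tgt Z.tgt W.tgt (w ⊗ₜ t)),
      TensorProduct.map LinearMap.id (LinearMap.inl k _ _)
        (TensorProduct.tensorTensorTensorComm k X.tgt Y.src Z.tgt W.tgt (w' ⊗ₜ t))) := by
  have h1 : (midExchange X Y Z W).src ∘ₗ LinearMap.inl k _ _ ∘ₗ
      TensorProduct.map (LinearMap.inl k _ _) LinearMap.id =
      LinearMap.inl k _ _ ∘ₗ TensorProduct.map (LinearMap.inl k _ _) LinearMap.id ∘ₗ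
        (TensorProduct.tensorTensorTensorComm k X.src Y.tgt Z.tgt W.tgt).toLinearMap := by
    ext <;> simp [midExchange, assoc, braid, prodRight_symm_pair, prodLeft_symm_pair,
      prodAssoc_symm_mk]
  have h2 : (midExchange X Y Z W).src ∘ₗ LinearMap.inl k _ _ ∘ₗ
      TensorProduct.map (LinearMap.inr k _ _) LinearMap.id =
      LinearMap.inr k _ _ ∘ₗ TensorProduct.map LinearMap.id (LinearMap.inl k _ _) ∘ₗ
        (TensorProduct.tensorTensorTensorComm k X.tgt Y.src Z.tgt W.tgt).toLinearMap := by
    ext <;> simp [midExchange, assoc, braid, prodRight_symm_pair, prodLeft_symm_pair,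
      prodAssoc_symm_mk]
  have h := congrArg₂ (· + ·) (LinearMap.congr_fun h1 (w ⊗ₜ t)) (LinearMap.congr_fun h2 (w' ⊗ₜ t))
  simpa [← map_add, ← TensorProduct.add_tmul] using h

theorem midExchange_src_inr (X Y Z W : LinMap.{u, v} k) (w : Z.src ⊗[k] W.tgt)
    (w' : Z.tgt ⊗[k] W.src) (t : X.tgt ⊗[k] Y.tgt) :
    (midExchange X Y Z W).src (0, t ⊗ₜ (w, w')) =
      (TensorProduct.map (LinearMap.inr k _ _) LinearMap.id
        (TensorProduct.tensorTensorTensorComm k X.tgt Y.tgt Z.src W.tgt (t ⊗ₜ w)),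
      TensorProduct.map LinearMap.id (LinearMap.inr k _ _)
        (TensorProduct.tensorTensorTensorComm k X.tgt Y.tgt Z.tgt W.src (t ⊗ₜ w'))) := by
  have h1 : (midExchange X Y Z W).src ∘ₗ LinearMap.inr k _ _ ∘ₗ
      TensorProduct.map LinearMap.id (LinearMap.inl k _ _) =
      LinearMap.inl k _ _ ∘ₗ TensorProduct.map (LinearMap.inr k _ _) LinearMap.id ∘ₗ
        (TensorProduct.tensorTensorTensorComm k X.tgt Y.tgt Z.src W.tgt).toLinearMap := by
    ext <;> simp [midExchange, assoc, braid, prodRight_symm_pair, prodLeft_symm_pair,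
      prodAssoc_symm_mk]
  have h2 : (midExchange X Y Z W).src ∘ₗ LinearMap.inr k _ _ ∘ₗ
      TensorProduct.map LinearMap.id (LinearMap.inr k _ _) =
      LinearMap.inr k _ _ ∘ₗ TensorProduct.map LinearMap.id (LinearMap.inr k _ _) ∘ₗ
        (TensorProduct.tensorTensorTensorComm k X.tgt Y.tgt Z.tgt W.src).toLinearMap := by
    ext <;> simp [midExchange, assoc, braid, prodRight_symm_pair, prodLeft_symm_pair,
      prodAssoc_symm_mk]
  have h := congrArg₂ (· + ·) (LinearMap.congr_fun h1 (t ⊗ₜ w)) (LinearMap.congr_fun h2 (t ⊗ₜ w'))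
  simpa [← map_add, ← TensorProduct.tmul_add] using h

end LinMap

/-! ### Bialgebra objects from tetramodules with a bilinear coderivation -/

variable {H M : Type (max u v)} [Ring H] [Bialgebra k H] [AddCommGroup M]
  [Module k M]

open LinMap

variable (f : M →ₗ[k] H) {lact : H ⊗[k] M →ₗ[k] M} {ract : M ⊗[k] H →ₗ[k] M}
    {lcoact : M →ₗ[k] H ⊗[k] M} {rcoact : M →ₗ[k] M ⊗[k] H}

variable (H M) in
/-- A linear map `M → H` as an object of the Loday-Pirashvili category. -/
abbrev linMapOf : LinMap.{u, v} k := LinMap.mk M H f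

/-- The product on `f : M → H` given by the product of `H` and the two actions on `M`. -/
def mulHom (hf : IsBilinearTo lact ract f) :
    tensor (linMapOf.{u, v} H M f) (linMapOf.{u, v} H M f) ⟶ linMapOf.{u, v} H M f where
  src := LinearMap.coprod ract lact
  tgt := LinearMap.mul' k H
  comm := by
    ext <;> simp [hf.1, hf.2]

/-- The coproduct on `f : M → H` given by the coproduct of `H` and the two coactions on `M`. -/
def comulHom (hf : IsCoderivation lcoact rcoact f) :
    linMapOf.{u, v} H M f ⟶ tensor (linMapOf.{u, v} H M f) (linMapOf.{u, v} H M f) where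
  src := LinearMap.prod rcoact lcoact
  tgt := comul (R := k) (A := H)
  comm := by
    ext m
    simp [hf m, add_comm]
    rfl

/-- The degree 1 part has the summands $M\otimes H\otimes H$, $H\otimes M\otimes H$ and $H\otimes
H\otimes M$, on which associativity is `ract_mul`, `lact_ract` and `mul_lact` respectively. -/
theorem mulHom_assoc (hM : IsHopfTetramodule lact ract lcoact rcoact)
    (hf : IsBilinearTo lact ract f) :
    tensorMap (mulHom.{u, v} f hf) (𝟙 _) ≫ mulHom.{u, v} f hf =
    (assoc _ _ _).hom ≫ tensorMap (𝟙 _) (mulHom.{u, v} f hf) ≫ mulHom.{u, v} f hf := by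
  ext <;> simp [mulHom, assoc, hM.ract_mul, hM.lact_ract, hM.mul_lact, mul_assoc,
    prodRight_symm_pair]

theorem unitTo_mulHom (hM : IsHopfTetramodule lact ract lcoact rcoact)
    (hf : IsBilinearTo lact ract f) :
    tensorMap (unitTo (linMapOf.{u, v} H M f) (1 : H)) (𝟙 _) ≫ mulHom.{u, v} f hf =
      (leftUnit _).hom := by
  ext <;> simp [mulHom, unitTo, leftUnit, hM.one_lact, ← TensorProduct.smul_tmul']

theorem mulHom_unitTo (hM : IsHopfTetramodule lact ract lcoact rcoact)
    (hf : IsBilinearTo lact ract f) :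
    tensorMap (𝟙 _) (unitTo (linMapOf.{u, v} H M f) (1 : H)) ≫ mulHom.{u, v} f hf =
      (rightUnit _).hom := by
  ext <;> simp [mulHom, unitTo, leftUnit, rightUnit, braid, hM.ract_one]

/-- Makes the counit with zero degree 1 part a commutative square. Applying
$\epsilon\otimes\epsilon$ to the coderivation rule gives
$\epsilon(f(m))=\epsilon(f(m))+\epsilon(f(m))$, so the characteristic plays no role. -/
theorem counit_coderivation (hM : IsHopfTetramodule lact ract lcoact rcoact)
    (hf : IsCoderivation lcoact rcoact f) : counit (R := k) ∘ₗ f = 0 := by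
  ext m
  have h := hf m
  have e1 : ∀ t : H ⊗[k] M, TensorProduct.lid k H ((counit (R := k)).rTensor H (f.lTensor H t)) =
      f (TensorProduct.lid k M ((counit (R := k)).rTensor M t)) := by
    intro t
    induction t with
    | zero => simp
    | add a b ha hb => simp only [map_add, ha, hb]
    | tmul a b => simp
  have e2 : ∀ t : M ⊗[k] H,
      counit (R := k) (TensorProduct.lid k H ((counit (R := k)).rTensor H (f.rTensor H t))) =
      counit (R := k) (f (TensorProduct.rid k M ((counit (R := k)).lTensor M t))) := by
    intro t
    induction t with
    | zero => simp
    | add a b ha hb => simp only [map_add, ha, hb]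
    | tmul a b => simp [mul_comm]
  have h1 := congrArg (fun t =>
    counit (R := k) (TensorProduct.lid k H ((counit (R := k)).rTensor H t))) h
  simp only [map_add, e1, e2, hM.counit_lcoact, hM.rcoact_counit, rTensor_counit_comul] at h1
  simpa using h1

omit [Module k M] in
theorem map_uliftUp_left {N : Type*} [AddCommGroup N] [Module k N] (e : H →ₗ[k] k) (t : H ⊗[k] N) :
    TensorProduct.map ((ULift.moduleEquiv : ULift.{v} k ≃ₗ[k] k).symm.toLinearMap ∘ₗ e)
      LinearMap.id t = ULift.up (1 : k) ⊗ₜ TensorProduct.lid k N (e.rTensor N t) := by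
  induction t with
  | zero => simp
  | add a b ha hb => simp only [map_add, ha, hb, TensorProduct.tmul_add]
  | tmul a b =>
    simp only [TensorProduct.map_tmul, LinearMap.rTensor_tmul, TensorProduct.lid_tmul,
      TensorProduct.tmul_smul, TensorProduct.smul_tmul']
    congr 1
    ext
    simp

theorem map_uliftUp_right {N : Type*} [AddCommGroup N] [Module k N] (e : H →ₗ[k] k)
    (t : N ⊗[k] H) : TensorProduct.map LinearMap.id
      ((ULift.moduleEquiv : ULift.{v} k ≃ₗ[k] k).symm.toLinearMap ∘ₗ e) t =
        TensorProduct.rid k N (e.lTensor N t) ⊗ₜ ULift.up (1 : k) := by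
  induction t with
  | zero => simp
  | add a b ha hb => simp only [map_add, ha, hb, TensorProduct.add_tmul]
  | tmul a b =>
    simp only [TensorProduct.map_tmul, LinearMap.lTensor_tmul, TensorProduct.rid_tmul,
      TensorProduct.smul_tmul]
    congr 1
    ext
    simp

theorem prodLeft_map_prod {A B D E : Type*} [AddCommGroup A] [Module k A] [AddCommGroup B]
    [Module k B] [AddCommGroup D] [Module k D] [AddCommGroup E] [Module k E] (r : E →ₗ[k] A)
    (l : E →ₗ[k] B) (t : E ⊗[k] D) :
    TensorProduct.prodLeft k k A B D (TensorProduct.map (r.prod l) LinearMap.id t) =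
      (r.rTensor D t, l.rTensor D t) := by
  induction t with
  | zero => simp only [map_zero]; rfl
  | add a b ha hb => simp only [map_add, ha, hb, Prod.mk_add_mk]
  | tmul a b => simp

theorem map_prod_right {A B D E : Type*} [AddCommGroup A] [Module k A] [AddCommGroup B]
    [Module k B] [AddCommGroup D] [Module k D] [AddCommGroup E] [Module k E] (r : E →ₗ[k] A)
    (l : E →ₗ[k] B) (t : D ⊗[k] E) :
    TensorProduct.map LinearMap.id (r.prod l) t =
      TensorProduct.map LinearMap.id (LinearMap.inl k A B) (r.lTensor D t) +
        TensorProduct.map LinearMap.id (LinearMap.inr k A B) (l.lTensor D t) := by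
  induction t with
  | zero => simp
  | add a b ha hb => simp only [map_add, ha, hb]; abel
  | tmul a b => simp [← TensorProduct.tmul_add]

theorem comulHom_assoc (hM : IsHopfTetramodule lact ract lcoact rcoact)
    (hf : IsCoderivation lcoact rcoact f) :
    comulHom.{u, v} f hf ≫ tensorMap (𝟙 _) (comulHom.{u, v} f hf) =
    comulHom.{u, v} f hf ≫ tensorMap (comulHom.{u, v} f hf) (𝟙 _) ≫ (assoc _ _ _).hom := by
  ext m
  all_goals simp [comulHom, assoc, prodRight_symm_pair]
  · rw [prodLeft_map_prod]
    exact (hM.rcoact_comul _).symm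
  -- This component holds both $H\otimes M\otimes H$ and $H\otimes H\otimes M$, so commuting
  -- coactions and left coassociativity enter together.
  · rw [prodLeft_map_prod, map_prod_right, hM.lcoact_rcoact, ← hM.comul_lcoact]
    rfl
  · exact (coassoc_apply (R := k) (A := H) m).symm

theorem comulHom_toUnit_left (hM : IsHopfTetramodule lact ract lcoact rcoact)
    (hf : IsCoderivation lcoact rcoact f) :
    comulHom.{u, v} f hf ≫
      tensorMap (toUnit _ (counit (R := k)) (counit_coderivation f hM hf)) (𝟙 _) =
      (leftUnit _).inv := by
  ext m
  all_goals simp [comulHom, toUnit, leftUnit]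
  · rw [map_uliftUp_left, hM.counit_lcoact]
  · change TensorProduct.map _ LinearMap.id (comul (R := k) (m : H)) = _
    rw [map_uliftUp_left, rTensor_counit_comul, TensorProduct.lid_tmul, one_smul]

theorem comulHom_toUnit_right (hM : IsHopfTetramodule lact ract lcoact rcoact)
    (hf : IsCoderivation lcoact rcoact f) :
    comulHom.{u, v} f hf ≫
      tensorMap (𝟙 _) (toUnit _ (counit (R := k)) (counit_coderivation f hM hf)) =
      (rightUnit _).inv := by
  ext m
  all_goals simp [comulHom, toUnit, leftUnit, rightUnit, braid]
  · rw [map_uliftUp_right, hM.rcoact_counit]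
  · change TensorProduct.map LinearMap.id _ (comul (R := k) (m : H)) = _
    rw [map_uliftUp_right, lTensor_counit_comul, TensorProduct.rid_tmul, one_smul]

/-- In degree 1, source summands $M\otimes H$, $H\otimes M$ and target summands $M\otimes H$,
$H\otimes M$ give four identities: the compatibilities of the two coactions with the two actions. -/
theorem mulHom_comulHom (hM : IsHopfTetramodule lact ract lcoact rcoact)
    (hf : IsBilinearTo lact ract f) (hf' : IsCoderivation lcoact rcoact f) :
    mulHom.{u, v} f hf ≫ comulHom.{u, v} f hf' =
      tensorMap (comulHom.{u, v} f hf') (comulHom.{u, v} f hf') ≫ midExchange _ _ _ _ ≫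
        tensorMap (mulHom.{u, v} f hf) (mulHom.{u, v} f hf) := by
  ext
  all_goals simp [comulHom, mulHom, midExchange_tgt, hM.rcoact_ract, hM.lcoact_ract,
    hM.rcoact_lact, hM.lcoact_lact, Bialgebra.comul_mul]
  · rw [midExchange_src_inl]
    simp only [← LinearMap.comp_apply (TensorProduct.map _ _), ← TensorProduct.map_comp,
      LinearMap.coprod_inl, LinearMap.comp_id]
  · rw [midExchange_src_inl]
    simp only [← LinearMap.comp_apply (TensorProduct.map _ _), ← TensorProduct.map_comp,
      LinearMap.coprod_inl, LinearMap.comp_id]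
  · rw [midExchange_src_inr]
    simp only [← LinearMap.comp_apply (TensorProduct.map _ _), ← TensorProduct.map_comp,
      LinearMap.coprod_inr, LinearMap.comp_id]
  · rw [midExchange_src_inr]
    simp only [← LinearMap.comp_apply (TensorProduct.map _ _), ← TensorProduct.map_comp,
      LinearMap.coprod_inr, LinearMap.comp_id]
  · rename_i x y
    change comul (R := k) (x : H) * comul (R := k) (y : H) = _
    induction comul (R := k) (x : H) with
    | zero => simp
    | add a b ha hb => simp only [TensorProduct.add_tmul, map_add, ha, hb, add_mul]
    | tmul a b =>
      induction comul (R := k) (y : H) with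
      | zero => simp
      | add a b ha hb => simp only [TensorProduct.tmul_add, map_add, ha, hb, mul_add]
      | tmul c d => simp

theorem IsHopfTetramodule.exists_bimonObj (hM : IsHopfTetramodule lact ract lcoact rcoact)
    (hf : IsBilinearTo lact ract f) (hf' : IsCoderivation lcoact rcoact f) :
    ∃ B : BimonObj (LinMap.mk M H f : LinMap.{u, v} k),
      (∀ c : k, B.one.tgt (ULift.up c) = algebraMap k H c) ∧
      B.mul.tgt = LinearMap.mul' k H ∧
      B.mul.src = LinearMap.coprod ract lact ∧
      (∀ x : H, B.counit.tgt x = ULift.up (counit (R := k) x)) ∧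
      B.comul.tgt = comul (R := k) (A := H) ∧
      B.comul.src = LinearMap.prod rcoact lcoact := by
  refine ⟨{
    one := unitTo _ (1 : H)
    mul := mulHom f hf
    one_mul := unitTo_mulHom f hM hf
    mul_one := mulHom_unitTo f hM hf
    mul_assoc := mulHom_assoc f hM hf
    counit := toUnit _ (counit (R := k)) (counit_coderivation f hM hf')
    comul := comulHom f hf'
    counit_comul := comulHom_toUnit_left f hM hf'
    comul_counit := comulHom_toUnit_right f hM hf'
    comul_assoc := comulHom_assoc f hM hf'
    mul_comul := mulHom_comulHom f hM hf hf'
    one_comul := ?_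
    mul_counit := ?_
    one_counit := ?_ }, ?_, rfl, rfl, ?_, rfl, rfl⟩
  -- The unit object vanishes in degree 1, so the content of the three remaining axioms is in degree
  -- 0: $1$ is group-like and $\epsilon$ is multiplicative.
  · change unitTo _ (1 : H) ≫ comulHom f hf' = (leftUnit (unit k)).inv ≫
      tensorMap (unitTo (linMapOf.{u, v} H M f) (1 : H)) (unitTo (linMapOf.{u, v} H M f) (1 : H))
    ext <;> simp [comulHom, unitTo, leftUnit, Algebra.TensorProduct.one_def]
  · change mulHom f hf ≫ toUnit _ (counit (R := k)) (counit_coderivation f hM hf') =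
      tensorMap (toUnit (linMapOf.{u, v} H M f) (counit (R := k)) (counit_coderivation f hM hf'))
        (toUnit (linMapOf.{u, v} H M f) (counit (R := k)) (counit_coderivation f hM hf')) ≫
        (leftUnit (unit k)).hom
    ext
    simp [mulHom, toUnit, leftUnit]
  · change unitTo (linMapOf.{u, v} H M f) (1 : H) ≫
      toUnit (linMapOf.{u, v} H M f) (counit (R := k)) (counit_coderivation f hM hf') = 𝟙 (unit k)
    ext
    simp [unitTo, toUnit]
  · intro c
    exact (Algebra.algebraMap_eq_smul_one c).symm
  · intro x
    rfl
end BimonoidObject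

/-! ### The action and coaction of $U(C)$ on $\ker\epsilon$ -/

section Envelope

open Coalgebra

variable {k : Type u} {C : Type v} [Field k] [AddCommGroup C] [Module k C] [Coalgebra k C]
  [RackBialgebra k C]

namespace RackBialgebra

/-- Scalars need no separate case, because $r = q(r\cdot 1)$. -/
theorem env_induction {P : Env k C → Prop} (hq : ∀ c, P (q k C c))
    (hmul : ∀ a b, P a → P b → P (a * b)) (hadd : ∀ a b, P a → P b → P (a + b)) (h : Env k C) :
    P h := by
  obtain ⟨t, rfl⟩ : ∃ t, toEnv k C t = h := RingQuot.mkAlgHom_surjective k (Rel k C) h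
  induction t using TensorAlgebra.induction with
  | algebraMap r =>
    have : toEnv k C (algebraMap k _ r) = q k C (r • one k) := by
      rw [map_smul, q_one, AlgHom.commutes, Algebra.algebraMap_eq_smul_one]
    rw [this]
    exact hq _
  | ι c =>
    have : toEnv k C (TensorAlgebra.ι k c) = q k C c := by
      simp [q, incl, LinearMap.mem_ker.mp c.2, toAug_coe]
    rw [this]
    exact hq _
  | mul a b ha hb => rw [map_mul]; exact hmul _ _ ha hb
  | add a b ha hb => rw [map_add]; exact hadd _ _ ha hb

theorem augAct_one (v : Aug k C) : augAct k C (v ⊗ₜ 1) = v := by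
  ext
  simp [augAct_apply]

theorem augAct_mul (v : Aug k C) (g h : Env k C) :
    augAct k C (v ⊗ₜ (g * h)) = augAct k C (augAct k C (v ⊗ₜ g) ⊗ₜ h) := by
  ext
  simp [augAct_apply]

/-- Follows from $1\lhd c=\epsilon(c)1$ and $\epsilon(x\lhd c)=\epsilon(x)\epsilon(c)$. It allows
the legs of a coproduct, which need not lie in $\ker\epsilon$, to be projected before or after
acting. -/
theorem toAug_rack (x c : C) :
    toAug k C (rack (k := k) (x ⊗ₜ[k] c)) = augAct k C (toAug k C x ⊗ₜ q k C c) := by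
  have h := CoalgHomClass.counit_comp_apply (rack (k := k) (C := C)) (x ⊗ₜ c)
  ext
  rw [augAct_apply, actHom_q, coe_toAug, coe_toAug, h, TensorProduct.sub_tmul, map_sub,
    ← TensorProduct.smul_tmul', map_smul, one_rack, smul_smul, TensorProduct.counit_tmul,
    smul_eq_mul, mul_comm]

theorem augAct_q (v : Aug k C) (c : C) :
    augAct k C (v ⊗ₜ q k C c) = toAug k C (rack (k := k) ((v : C) ⊗ₜ[k] c)) := by
  rw [toAug_rack, toAug_coe]

theorem q_toAug (c : C) : q k C (toAug k C c) = q k C c - counit (R := k) c • 1 := by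
  rw [coe_toAug, map_sub, map_smul, q_one]

theorem augCoact_apply (v : Aug k C) : augCoact k C v =
    TensorProduct.map (toAug k C) (q k C) (comul (R := k) (v : C)) := rfl

/-- The summand $\epsilon(c)1$ removed by `toAug` contributes nothing, since $\triangle(1)=1\otimes
1$ and `toAug` kills $1$. -/
theorem augCoact_toAug (c : C) : augCoact k C (toAug k C c) =
    TensorProduct.map (toAug k C) (q k C) (comul (R := k) c) := by
  simp [augCoact_apply, coe_toAug, comul_one, toAug_one]

theorem envMap_tmul (h : Env k C) (v : Aug k C) : envMap k C (h ⊗ₜ v) = h * q k C (v : C) := rfl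

variable [IsCocomm k C]

theorem comul_q (c : C) : comul (R := k) (q k C c) =
    TensorProduct.map (q k C) (q k C) (comul (R := k) c) := envComul_q k C c

theorem counit_q (c : C) : counit (R := k) (q k C c) = counit (R := k) c := envCounit_q k C c

theorem augCoact_counit (v : Aug k C) : TensorProduct.rid k (Aug k C)
    ((counit (R := k) (A := Env k C)).lTensor (Aug k C) (augCoact k C v)) = v := by
  have e : ∀ t : C ⊗[k] C, TensorProduct.rid k (Aug k C)
      ((counit (R := k) (A := Env k C)).lTensor (Aug k C)
        (TensorProduct.map (toAug k C) (q k C) t)) =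
      toAug k C (TensorProduct.rid k C ((counit (R := k)).lTensor C t)) := by
    intro t
    induction t with
    | zero => simp
    | add a b ha hb => simp only [map_add, ha, hb]
    | tmul a b => simp [counit_q]
  rw [augCoact_apply, e, lTensor_counit_comul]
  simp [toAug_coe]

theorem augCoact_comul (v : Aug k C) : TensorProduct.assoc k (Aug k C) (Env k C) (Env k C)
    ((augCoact k C).rTensor (Env k C) (augCoact k C v)) =
      (comul (R := k) (A := Env k C)).lTensor (Aug k C) (augCoact k C v) := by
  let F := TensorProduct.map (toAug k C) (TensorProduct.map (q k C) (q k C))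
  have e1 : ∀ t : C ⊗[k] C, TensorProduct.assoc k (Aug k C) (Env k C) (Env k C)
      ((augCoact k C).rTensor (Env k C) (TensorProduct.map (toAug k C) (q k C) t)) =
      F (TensorProduct.assoc k C C C ((comul (R := k)).rTensor C t)) := by
    intro t
    induction t with
    | zero => simp
    | add a b ha hb => simp only [map_add, ha, hb]
    | tmul a b =>
      simp only [TensorProduct.map_tmul, LinearMap.rTensor_tmul, augCoact_toAug]
      induction comul (R := k) a with
      | zero => simp
      | add a b ha hb => simp only [TensorProduct.add_tmul, map_add, ha, hb]
      | tmul a b => simp [F]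
  have e2 : ∀ t : C ⊗[k] C, (comul (R := k) (A := Env k C)).lTensor (Aug k C)
      (TensorProduct.map (toAug k C) (q k C) t) = F ((comul (R := k)).lTensor C t) := by
    intro t
    induction t with
    | zero => simp
    | add a b ha hb => simp only [map_add, ha, hb]
    | tmul a b => simp [F, comul_q]
  rw [augCoact_apply, e1, e2, coassoc_apply]

/-- `g₁ q(v · g₂) = q(v) g` -/
theorem mul_q_augAct (v : Aug k C) (g : Env k C) :
    LinearMap.mul' k (Env k C) ((q k C ∘ₗ (Aug k C).subtype ∘ₗ augAct k C ∘ₗ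
      TensorProduct.mk k (Aug k C) (Env k C) v).lTensor (Env k C) (comul (R := k) g)) =
      q k C (v : C) * g := by
  induction g using env_induction generalizing v with
  | hq c =>
    -- On generators the claim is the defining relation of $U$.
    rw [← q_rel, comul_q]
    congr 1
    rw [← LinearMap.comp_apply, LinearMap.lTensor_comp_map]
    congr 2
    ext c
    simp [augAct_apply, actHom_q]
  | hadd a b ha hb => simp only [map_add, ha, hb, mul_add]
  | hmul a b ha hb =>
    -- $q(v)ab=a_1q(v\cdot a_2)b=a_1b_1q((v\cdot a_2)\cdot b_2)$; the hypothesis for $b$ is used at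
    -- $v\cdot a_2$, hence the induction for all `v`.
    rw [← mul_assoc, ← ha, Bialgebra.comul_mul]
    induction comul (R := k) a with
    | zero => simp
    | add s t hs ht => simp only [add_mul, map_add, hs, ht]
    | tmul x y =>
      simp only [LinearMap.lTensor_tmul, LinearMap.comp_apply, TensorProduct.mk_apply,
        LinearMap.mul'_apply, Submodule.subtype_apply]
      rw [mul_assoc, ← hb]
      induction comul (R := k) b with
      | zero => simp
      | add s t hs ht => simp only [mul_add, map_add, hs, ht]
      | tmul z w => simp [augAct_mul, mul_assoc]

omit [RackBialgebra k C] in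
-- The first two legs of the iterated coproduct may be exchanged: after rebracketing they form a
-- single coproduct, and cocommutativity applies.
theorem leftComm_lTensor_comul (c : C) : TensorProduct.leftComm k C C C
    ((comul (R := k)).lTensor C (comul (R := k) c)) =
      (comul (R := k)).lTensor C (comul (R := k) c) := by
  have e : ∀ t : (C ⊗[k] C) ⊗[k] C, TensorProduct.leftComm k C C C (TensorProduct.assoc k C C C t) =
      TensorProduct.assoc k C C C ((TensorProduct.comm k C C).toLinearMap.rTensor C t) := by
    intro t
    induction t with
    | zero => simp
    | add a b ha hb => simp only [map_add, ha, hb]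
    | tmul s c =>
      induction s with
      | zero => simp
      | add a b ha hb => simp only [TensorProduct.add_tmul, map_add, ha, hb]
      | tmul a b => simp
  have h : (TensorProduct.comm k C C).toLinearMap ∘ₗ comul (R := k) (A := C) = comul :=
    LinearMap.ext fun c => comm_comul k c
  rw [← coassoc_apply, e, ← LinearMap.rTensor_comp_apply, h]

/-! ### The Yetter–Drinfeld identity for $\ker\epsilon$ -/

theorem augAct_compat_q (v : Aug k C) (c : C) :
    twistedCoact (augAct k C) (augCoact k C) v (comul (R := k) (q k C c)) =
      diagAct (augAct k C) (augCoact k C v ⊗ₜ comul (R := k) (q k C c)) := by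
  -- `(x ⊗ y) ⊗ (a ⊗ (p ⊗ r)) ↦ (x ◁ p - ε(x ◁ p) 1) ⊗ q(a) q(y ◁ r)`
  let F : (C ⊗[k] C) ⊗[k] (C ⊗[k] (C ⊗[k] C)) →ₗ[k] Aug k C ⊗[k] Env k C :=
    TensorProduct.map (toAug k C ∘ₗ (rack (k := k) (C := C)).toLinearMap)
      (LinearMap.mul' k (Env k C) ∘ₗ
        TensorProduct.map (q k C) (q k C ∘ₗ (rack (k := k) (C := C)).toLinearMap) ∘ₗ
        (TensorProduct.leftComm k C C C).toLinearMap) ∘ₗ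
    (TensorProduct.tensorTensorTensorComm k C C C (C ⊗[k] C)).toLinearMap ∘ₗ
    (TensorProduct.leftComm k C C C).toLinearMap.lTensor (C ⊗[k] C)
  have e1 : ∀ t : C ⊗[k] C, twistedCoact (augAct k C) (augCoact k C) v
      (TensorProduct.map (q k C) (q k C) t) =
      F (comul (R := k) (v : C) ⊗ₜ (comul (R := k)).lTensor C t) := by
    intro t
    induction t with
    | zero => simp
    | add a b ha hb => simp only [TensorProduct.tmul_add, map_add, ha, hb]
    | tmul a b =>
      rw [TensorProduct.map_tmul, twistedCoact_tmul, augAct_q, augCoact_toAug, comul_rack,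
        LinearMap.lTensor_tmul]
      induction comul (R := k) (v : C) with
      | zero => simp
      | add a b ha hb => simp only [TensorProduct.add_tmul, map_add, ha, hb]
      | tmul x y =>
        induction comul (R := k) b with
        | zero => simp
        | add a b ha hb => simp only [TensorProduct.tmul_add, map_add, ha, hb]
        | tmul p r => simp [F]
  have e2 : ∀ w s : C ⊗[k] C,
      F (w ⊗ₜ TensorProduct.leftComm k C C C ((comul (R := k)).lTensor C s)) =
        diagAct (augAct k C) (TensorProduct.map (toAug k C) (q k C) w ⊗ₜ
          TensorProduct.map (q k C) (q k C) s) := by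
    intro w s
    induction w with
    | zero => simp
    | add a b ha hb => simp only [TensorProduct.add_tmul, map_add, ha, hb]
    | tmul x y =>
      induction s with
      | zero => simp
      | add a b ha hb => simp only [TensorProduct.tmul_add, map_add, ha, hb]
      | tmul a b =>
        rw [TensorProduct.map_tmul, TensorProduct.map_tmul, diagAct_tmul, ← toAug_rack, ← q_rel,
          LinearMap.lTensor_tmul]
        induction comul (R := k) b with
        | zero => simp
        | add a b ha hb => simp only [TensorProduct.tmul_add, map_add, ha, hb]
        | tmul p r => simp [F]
  -- `e1` puts $c_2$ on the first factor and $q(c_1)$ in the second; `e2`, through `q_rel`, has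
  -- $c_1$ and $q(c_2)$ instead. Exchanging the two legs identifies them.
  rw [comul_q, e1, ← leftComm_lTensor_comul, e2, augCoact_apply]

theorem isYetterDrinfeld : IsYetterDrinfeld (augAct k C) (augCoact k C) where
  act_one := augAct_one
  act_mul := augAct_mul
  coact_counit := augCoact_counit
  coact_comul := augCoact_comul
  compat v g := by
    induction g using env_induction generalizing v with
    | hq c => exact augAct_compat_q v c
    | hadd a b ha hb => simp only [map_add, TensorProduct.tmul_add, ha, hb]
    | hmul a b ha hb =>
      -- The hypothesis for $b$ makes the twisted coaction turn right multiplication by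
      -- $\triangle(b)$ into the diagonal action. With the hypothesis for $a$, it remains that
      -- `diagAct` is an action of $U\otimes U$.
      have e1 : ∀ s : Env k C ⊗[k] Env k C,
          twistedCoact (augAct k C) (augCoact k C) v (s * comul (R := k) b) =
            diagAct (augAct k C)
              (twistedCoact (augAct k C) (augCoact k C) v s ⊗ₜ comul (R := k) b) := by
        intro s
        induction s with
        | zero => simp
        | add s t hs ht => simp only [add_mul, TensorProduct.add_tmul, map_add, hs, ht]
        | tmul x y =>
          -- The factor $y$ moves onto $v$, so the hypothesis for $b$ is needed at $v\cdot y$.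
          have h1 : twistedCoact (augAct k C) (augCoact k C) v (x ⊗ₜ y * comul (R := k) b) =
              (LinearMap.mulLeft k x).lTensor (Aug k C) (twistedCoact (augAct k C) (augCoact k C)
                (augAct k C (v ⊗ₜ y)) (comul (R := k) b)) := by
            induction comul (R := k) b with
            | zero => simp
            | add s t hs ht => simp only [mul_add, map_add, hs, ht]
            | tmul z w =>
              simp [twistedCoact_tmul, augAct_mul, LinearMap.mulLeft_mul,
                LinearMap.lTensor_comp_apply]
          rw [h1, hb, twistedCoact_tmul]
          induction augCoact k C (augAct k C (v ⊗ₜ y)) with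
          | zero => simp
          | add s t hs ht => simp only [TensorProduct.add_tmul, map_add, hs, ht]
          | tmul p r =>
            induction comul (R := k) b with
            | zero => simp
            | add s t hs ht => simp only [TensorProduct.tmul_add, map_add, hs, ht]
            | tmul z w => simp [diagAct_tmul, mul_assoc]
      rw [Bialgebra.comul_mul, e1, ha]
      induction augCoact k C v with
      | zero => simp
      | add s t hs ht => simp only [TensorProduct.add_tmul, map_add, hs, ht]
      | tmul p r =>
        induction comul (R := k) a with
        | zero => simp
        | add s t hs ht =>
          simp only [TensorProduct.tmul_add, TensorProduct.add_tmul, map_add, hs, ht, add_mul]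
        | tmul x y =>
          induction comul (R := k) b with
          | zero => simp
          | add s t hs ht => simp only [TensorProduct.tmul_add, map_add, hs, ht, mul_add]
          | tmul z w => simp [diagAct_tmul, augAct_mul, mul_assoc]

/-! ### The map $f$ is bilinear and a coderivation -/

theorem envMap_isBilinearTo :
    IsBilinearTo (leftAct k (Env k C) (Aug k C)) (rightAct (augAct k C)) (envMap k C) := by
  constructor
  · intro h m
    induction m with
    | zero => simp
    | add a b ha hb => simp only [TensorProduct.tmul_add, map_add, ha, hb, mul_add]
    | tmul x v => simp [leftAct_tmul, envMap_tmul, mul_assoc]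
  · intro m h
    induction m with
    | zero => simp
    | add a b ha hb => simp only [TensorProduct.add_tmul, map_add, ha, hb, add_mul]
    | tmul x v =>
      rw [rightAct_tmul, envMap_tmul, mul_assoc, ← mul_q_augAct]
      induction comul (R := k) h with
      | zero => simp
      | add a b ha hb => simp only [map_add, ha, hb, mul_add]
      | tmul a b => simp [envMap_tmul, mul_assoc]

theorem envMap_isCoderivation :
    IsCoderivation (leftCoact k (Env k C) (Aug k C)) (rightCoact (augCoact k C)) (envMap k C) := by
  intro m
  induction m with
  | zero => simp
  | add a b ha hb => rw [map_add, map_add, ha, hb]; simp only [map_add]; abel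
  | tmul x v =>
    -- Splits the first leg as $a=\epsilon(a)1+(a-\epsilon(a)1)$. For $t=\triangle(v)$ this reads
    -- $\triangle q(v)=1\otimes q(v)+q(v_{(0)})\otimes v_{(1)}$; multiplied by $\triangle(x)$, the
    -- two terms become the left and right coaction terms.
    have e : ∀ t : C ⊗[k] C, TensorProduct.map (q k C) (q k C) t =
        1 ⊗ₜ q k C (TensorProduct.lid k C ((counit (R := k)).rTensor C t)) +
          (q k C ∘ₗ (Aug k C).subtype).rTensor (Env k C)
            (TensorProduct.map (toAug k C) (q k C) t) := by
      intro t
      induction t with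
      | zero => simp
      | add a b ha hb =>
        rw [map_add, ha, hb]
        simp only [map_add, TensorProduct.tmul_add]
        abel
      | tmul a b => simp [q_toAug, TensorProduct.sub_tmul, TensorProduct.smul_tmul']
    rw [envMap_tmul, Bialgebra.comul_mul, comul_q, e, rTensor_counit_comul, leftCoact_tmul,
      rightCoact_tmul, augCoact_apply, mul_add]
    congr 1
    · induction comul (R := k) x with
      | zero => simp
      | add a b ha hb => simp only [add_mul, TensorProduct.add_tmul, map_add, ha, hb]
      | tmul a b => simp [envMap_tmul]
    · induction TensorProduct.map (toAug k C) (q k C) (comul (R := k) (v : C)) with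
      | zero => simp
      | add a b ha hb => simp only [mul_add, TensorProduct.tmul_add, map_add, ha, hb]
      | tmul v w =>
        induction comul (R := k) x with
        | zero => simp
        | add a b ha hb => simp only [add_mul, TensorProduct.add_tmul, map_add, ha, hb]
        | tmul a b => simp [envMap_tmul]

end RackBialgebra

end Envelope

end

theorem mainTheorem2 {k : Type u} {C : Type v} [Field k] [AddCommGroup C] [Module k C]
    [Coalgebra k C] [Coalgebra.IsCocomm k C] [RackBialgebra k C] :
    IsHopfTetramodule (leftAct k (RackBialgebra.Env k C) (RackBialgebra.Aug k C))
        (rightAct (RackBialgebra.augAct k C))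
        (leftCoact k (RackBialgebra.Env k C) (RackBialgebra.Aug k C))
        (rightCoact (RackBialgebra.augCoact k C)) ∧
      IsBilinearTo (leftAct k (RackBialgebra.Env k C) (RackBialgebra.Aug k C))
        (rightAct (RackBialgebra.augAct k C)) (RackBialgebra.envMap k C) ∧
      IsCoderivation (leftCoact k (RackBialgebra.Env k C) (RackBialgebra.Aug k C))
        (rightCoact (RackBialgebra.augCoact k C)) (RackBialgebra.envMap k C) ∧
      ∃ B : CategoryTheory.BimonObj (RackBialgebra.envLinMap k C),
        (∀ c : k, B.one.tgt (ULift.up c) = algebraMap k (RackBialgebra.Env k C) c) ∧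
        B.mul.tgt = LinearMap.mul' k (RackBialgebra.Env k C) ∧
        B.mul.src = LinearMap.coprod (rightAct (RackBialgebra.augAct k C))
          (leftAct k (RackBialgebra.Env k C) (RackBialgebra.Aug k C)) ∧
        (∀ x : RackBialgebra.Env k C,
          B.counit.tgt x = ULift.up (Coalgebra.counit (R := k) x)) ∧
        B.comul.tgt = Coalgebra.comul (R := k) (A := RackBialgebra.Env k C) ∧
        B.comul.src = LinearMap.prod (rightCoact (RackBialgebra.augCoact k C))
          (leftCoact k (RackBialgebra.Env k C) (RackBialgebra.Aug k C)) := by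
  exact ⟨RackBialgebra.isYetterDrinfeld.isHopfTetramodule, RackBialgebra.envMap_isBilinearTo,
    RackBialgebra.envMap_isCoderivation,
    RackBialgebra.isYetterDrinfeld.isHopfTetramodule.exists_bimonObj.{u, v} _
      RackBialgebra.envMap_isBilinearTo RackBialgebra.envMap_isCoderivation⟩
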